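/- **Setting.** States are real numbers, $A$ is a measurable space of actions, and the dynamics are $S_{t+1}=f(S_t,A_t)+\varepsilon_t$ with $\varepsilon_t\sim\mathcal N(0,\sigma^2)$, $\sigma^2>0$. The unknown $\theta=(f,\sigma^2)$ ranges over a (pseudo)metric space $(\Theta,d)$ whose open sets are measurable; $f_\theta(s,a)$ is jointly measurable in $(\theta,s,a)$, $\sigma_\theta^2$ is measurable, and for every $(s,a)$ the maps $\theta\mapsto f_\theta(s,a)$ and $\theta\mapsto\sigma^2_\theta$ are continuous at the true parameter $\theta_0$. Write $p_\theta(\cdot\mid s,a)=\mathcal N(f_\theta(s,a),\sigma_\theta^2)$. The data are $\mathcal D^n=\{(s_i,a_i,s_i')\}_{i<n}$, where $(s_i,a_i)$ is chosen, possibly at random, from the earlier data by a rule not depending on $\theta$, and $s_i'\sim p_\theta(\cdot\mid s_i,a_i)$; $P^n_\theta$ is the law of $\mathcal D^n$. The prior $p(\theta)$ is a probability measure with a density with respect to a $\sigma$-finite reference measure $\lambda$; $p(\theta\mid\mathcal D^n)$ is the posterior, and $H$ is the entropy $H[\nu]=-\int\log\frac{d\nu}{d\lambda}\,d\nu$. The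 information gain given $\mathcal D^n$ is $$\mathrm{IG}_\theta(s,a,s')=H[p(\theta\mid\mathcal D^n)]-H[p(\theta\mid\mathcal D^n,(s,a,s'))].$$ **Assumptions.** 1. (KL support) For every $\varepsilon>0$ the prior gives positive mass to $\{\theta:\ \mathrm{KL}(P^n_{\theta_0}\,\|\,P^n_\theta)\le n\varepsilon\ \text{for all } n\}$. 2. (Testability) For every $r>0$ there are measurable $\varphi_n$ with values in $[0,1]$ and constants $b,B>0$ with $\mathbb E_{P^n_{\theta_0}}\varphi_n\le Be^{-bn}$ and $\sup_{d(\theta,\theta_0)>r}\mathbb E_{P_\theta^n}(1-\varphi_n)\le Be^{-bn}$ for all $n$. 3. The posterior entropies are finite for every finite data set, and the information gains are bounded in mean square: there is $C$ such that, for all $n,s,a$, $\mathbb E_{\mathcal D^n\sim P^n_{\theta_0}}\big[\int \mathrm{IG}_\theta(s,a,s')^2\,p_{\theta_0}(ds'\mid s,a)+\int \mathrm{IG}_\theta(s,a,s')^2\,p(ds'\mid s,a,\mathcal D^n)\big]\le C$, where $p(\cdot\mid s,a,\mathcal D^n)$ is the posterior predictive law. (The second requirement holds in particular if the information gains are uniformly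 bounded.) 4. The extrinsic reward $r^e(s,a)$ is bounded and measurable, $\gamma\in(0,1)$, $\eta\in\mathbb R$, $\pi(\cdot\mid s)$ is a (stochastic) policy and $p_0$ an initial state distribution. **Values.** For a reward $r(s,a,s')$ let $V^\pi(s)=\sum_{t\ge0}\gamma^t\,\mathbb E[r(s_t,a_t,s_{t+1})\mid s_0=s]$, where $a_t\sim\pi(\cdot\mid s_t)$ and $s_{t+1}\sim p_{\theta_0}(\cdot\mid s_t,a_t)$, so that $V^\pi(s)=\mathbb E_{a\sim\pi(\cdot\mid s)}\mathbb E_{s'\sim p_{\theta_0}(\cdot\mid s,a)}[r(s,a,s')+\gamma V^\pi(s')]$; let $Q^\pi(s,a)=\mathbb E_{s'\sim p_{\theta_0}(\cdot\mid s,a)}[r(s,a,s')+\gamma V^\pi(s')]$ and $J(\pi)=\sum_{t=0}^{T}\gamma^t\,\mathbb E_{s_0\sim p_0}[r(s_t,a_t,s_{t+1})]$ with horizon $T\in\mathbb N\cup\{\infty\}$. The index MDP means $r=r^e(s,a)$. The index BAMDP means $r=r^e(s,a)+\eta\,\mathrm{IG}_\theta(s,a,s')$, the information gain being computed from the belief $p(\theta\mid\mathcal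 D^n)$. **Claim.** As $n\to\infty$, in probability under the data law $P^n_{\theta_0}$, $$V^\pi_{\mathrm{BAMDP}}(s)\to V^\pi_{\mathrm{MDP}}(s),\qquad Q^\pi_{\mathrm{BAMDP}}(s,a)\to Q^\pi_{\mathrm{MDP}}(s,a),\qquad J_{\mathrm{BAMDP}}(\pi)\to J_{\mathrm{MDP}}(\pi)$$ for every state $s$, every action $a$, and every horizon $T\in\mathbb N\cup\{\infty\}$. -/

import Mathlib

open MeasureTheory ProbabilityTheory Filter Topology
open scoped ENNReal NNReal

noncomputable section

namespace InfoGain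

/-- A transition `((s, a), s')`. States are real numbers; `A` is the action space. -/
abbrev Transition (A : Type*) : Type _ := (ℝ × A) × ℝ

/-- A parametrised family of dynamics `S' = f(S, A) + ε` with `ε ∼ N(0, σ²)`: the parameter `θ`
stands for the pair `(f, σ²)`, with `f = mean θ` and `σ² = var θ > 0`. (For a function class `F`
one takes `Θ = F × (0, ∞)`, or `Θ = F` when `σ²` is treated as known.) -/
structure GaussianDynamics (A Θ : Type*) [MeasurableSpace A] [MeasurableSpace Θ] where
  mean : Θ → ℝ × A → ℝ
  var : Θ → ℝ≥0
  var_pos : ∀ θ, 0 < var θ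
  measurable_mean : Measurable (Function.uncurry mean)
  measurable_var : Measurable var

section Model

variable {A Θ : Type*} [MeasurableSpace A] [MeasurableSpace Θ]

/-- The transition law `p(s' | s, a; θ) = N(f(s, a), σ²)`, jointly in `θ` and `(s, a)`. -/
def GaussianDynamics.jointKernel (M : GaussianDynamics A Θ) : Kernel (Θ × (ℝ × A)) ℝ where
  toFun p := gaussianReal (M.mean p.1 p.2) (M.var p.1)
  measurable' := measurable_gaussianReal.comp
    (M.measurable_mean.prodMk (M.measurable_var.comp measurable_fst))

instance (M : GaussianDynamics A Θ) : IsMarkovKernel M.jointKernel :=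
  ⟨fun p => inferInstanceAs (IsProbabilityMeasure (gaussianReal (M.mean p.1 p.2) (M.var p.1)))⟩

/-- The transition law `p(· | s, a; θ)` for a fixed parameter `θ`. -/
def GaussianDynamics.trans (M : GaussianDynamics A Θ) (θ : Θ) : Kernel (ℝ × A) ℝ :=
  Kernel.sectR M.jointKernel θ

instance (M : GaussianDynamics A Θ) (θ : Θ) : IsMarkovKernel (M.trans θ) := by
  unfold GaussianDynamics.trans; infer_instance

/-- Law `P_θ^n` of the data `D^n = ((s_i, a_i), s'_i)_{i < n}`. The `n`-th pair `(s_n, a_n)` is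
chosen from the previous data by the sampling rule `ρ n`, which does not depend on `θ`; then
`s'_n ∼ p(· | s_n, a_n; θ)`. A trajectory `s_{n+1} = s'_n` is one of the possible rules. -/
def dataLaw (M : GaussianDynamics A Θ)
    (ρ : (n : ℕ) → Kernel (Fin n → Transition A) (ℝ × A)) (θ : Θ) :
    (n : ℕ) → Measure (Fin n → Transition A)
  | 0 => Measure.dirac (fun i => i.elim0)
  | n + 1 =>
      ((dataLaw M ρ θ n) ⊗ₘ ((ρ n) ⊗ₖ (Kernel.prodMkLeft (Fin n → Transition A) (M.trans θ)))).map
        (fun p => (Fin.snoc p.1 p.2 : Fin (n + 1) → Transition A))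

lemma measurable_snoc (n : ℕ) :
    Measurable (fun p : (Fin n → Transition A) × Transition A =>
      (Fin.snoc p.1 p.2 : Fin (n + 1) → Transition A)) := by
  refine measurable_pi_iff.mpr fun i => ?_
  refine Fin.lastCases ?_ (fun j => ?_) i
  · simpa using measurable_snd
  · simpa [Function.comp_def] using (measurable_pi_apply (X := fun _ => Transition A) j).comp
      (measurable_fst (β := Transition A))

instance isProbabilityMeasure_dataLaw (M : GaussianDynamics A Θ)
    (ρ : (n : ℕ) → Kernel (Fin n → Transition A) (ℝ × A)) [∀ n, IsMarkovKernel (ρ n)]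
    (θ : Θ) (n : ℕ) : IsProbabilityMeasure (dataLaw M ρ θ n) := by
  induction n with
  | zero => unfold dataLaw; infer_instance
  | succ n ih =>
    unfold dataLaw
    exact Measure.isProbabilityMeasure_map (measurable_snoc n).aemeasurable

/-- The likelihood `∏ i, p(s'_i | s_i, a_i; θ)` of a data set. -/
def likelihood (M : GaussianDynamics A Θ) {n : ℕ} (D : Fin n → Transition A) (θ : Θ) : ℝ≥0∞ :=
  ∏ i, gaussianPDF (M.mean θ (D i).1) (M.var θ) (D i).2

/-- The posterior `p(θ | D^n) ∝ p(D^n | θ) p(θ)`, normalised. -/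
def bayesPosterior (M : GaussianDynamics A Θ) (prior : Measure Θ) {n : ℕ}
    (D : Fin n → Transition A) : Measure Θ :=
  (∫⁻ θ, likelihood M D θ ∂prior)⁻¹ • prior.withDensity (likelihood M D)

/-- The posterior predictive law of `s'` at `(s, a)` given the data `D^n`. -/
def predictive (M : GaussianDynamics A Θ) (prior : Measure Θ) {n : ℕ}
    (D : Fin n → Transition A) (x : ℝ × A) : Measure ℝ :=
  (bayesPosterior M prior D).bind (fun θ => M.trans θ x)

/-- The entropy `H[ν] = E_ν[- log (dν/dlam)]` of a belief `ν` whose density is taken with respect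
to the reference measure `lam` (Shannon entropy when `lam` is a counting measure, differential
entropy when it is Lebesgue measure). -/
def entropy (lam ν : Measure Θ) : ℝ := ∫ θ, -llr ν lam θ ∂ν

/-- Information gain `IG_θ(s, a, s')` given the data `D^n`: the entropy of the posterior
`p(θ | D^n)` minus the entropy of the posterior once `(s, a, s')` is added to the data. -/
def infoGain (M : GaussianDynamics A Θ) (prior lam : Measure Θ) {n : ℕ}
    (D : Fin n → Transition A) (s : ℝ) (a : A) (s' : ℝ) : ℝ :=
  entropy lam (bayesPosterior M prior D) -
    entropy lam (bayesPosterior M prior (Fin.snoc D ((s, a), s') : Fin (n + 1) → Transition A))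

/-- `θ₀` lies in the Kullback-Leibler support of the prior: every set of parameters whose data law
is within `ε` of the true one, in Kullback-Leibler divergence per observation, has positive prior
mass. For independent identically distributed data the condition on `θ` is
`KL(p_θ₀, p_θ) ≤ ε` for a single observation. -/
def KLSupport (M : GaussianDynamics A Θ) (prior : Measure Θ)
    (ρ : (n : ℕ) → Kernel (Fin n → Transition A) (ℝ × A)) (θ₀ : Θ) : Prop :=
  ∀ ε : ℝ, 0 < ε →
    0 < prior {θ | ∀ n : ℕ, InformationTheory.klDiv (dataLaw M ρ θ₀ n) (dataLaw M ρ θ n)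
      ≤ ENNReal.ofReal (n * ε)}

/-- Testability: for every neighbourhood of `θ₀` there are tests `φ n` of `θ₀` against the
complement of the neighbourhood, with errors of both kinds exponentially small in `n`. -/
def Testable [PseudoMetricSpace Θ] (M : GaussianDynamics A Θ)
    (ρ : (n : ℕ) → Kernel (Fin n → Transition A) (ℝ × A)) (θ₀ : Θ) : Prop :=
  ∀ r : ℝ, 0 < r → ∃ φ : (n : ℕ) → (Fin n → Transition A) → ℝ,
    (∀ n, Measurable (φ n)) ∧ (∀ n D, 0 ≤ φ n D ∧ φ n D ≤ 1) ∧
    ∃ b B : ℝ, 0 < b ∧ 0 < B ∧ ∀ n : ℕ,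
      ∫ D, φ n D ∂(dataLaw M ρ θ₀ n) ≤ B * Real.exp (-b * n) ∧
      ∀ θ, r < dist θ θ₀ →
        ∫ D, (1 - φ n D) ∂(dataLaw M ρ θ n) ≤ B * Real.exp (-b * n)

/-- The information gains have second moments bounded uniformly in `n`, `s` and `a`, the new state
being drawn from the true dynamics or from the posterior predictive law. -/
def BoundedInfoGain (M : GaussianDynamics A Θ) (prior lam : Measure Θ)
    (ρ : (n : ℕ) → Kernel (Fin n → Transition A) (ℝ × A)) (θ₀ : Θ) : Prop :=
  ∃ C : ℝ≥0, ∀ (n : ℕ) (s : ℝ) (a : A),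
    ∫⁻ D, ∫⁻ s', ‖infoGain M prior lam D s a s'‖ₑ ^ 2
      ∂(M.trans θ₀ (s, a) + predictive M prior D (s, a)) ∂(dataLaw M ρ θ₀ n) ≤ C

end Model

section Values

variable {A : Type*} [MeasurableSpace A]

/-- `E[r(s_t, a_t, s_{t+1}) | s_0 = s]` when `a_t ∼ pol(· | s_t)` and
`s_{t+1} ∼ P(· | s_t, a_t)`. -/
def expectedReward (P : Kernel (ℝ × A) ℝ) (pol : Kernel ℝ A) (r : ℝ → A → ℝ → ℝ) : ℕ → ℝ → ℝ
  | 0, s => ∫ a, ∫ s', r s a s' ∂(P (s, a)) ∂(pol s)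
  | t + 1, s => ∫ a, ∫ s', expectedReward P pol r t s' ∂(P (s, a)) ∂(pol s)

/-- The state-value function `V(s) = E[∑ t, γ ^ t * r(s_t, a_t, s_{t+1}) | s_0 = s]`. -/
def stateValue (P : Kernel (ℝ × A) ℝ) (pol : Kernel ℝ A) (γ : ℝ) (r : ℝ → A → ℝ → ℝ)
    (s : ℝ) : ℝ :=
  ∑' t : ℕ, γ ^ t * expectedReward P pol r t s

/-- The action-value function, by the one-step Bellman equation from the state-value function. -/
def actionValue (P : Kernel (ℝ × A) ℝ) (pol : Kernel ℝ A) (γ : ℝ) (r : ℝ → A → ℝ → ℝ)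
    (s : ℝ) (a : A) : ℝ :=
  (∫ s', r s a s' ∂(P (s, a))) + γ * ∫ s', stateValue P pol γ r s' ∂(P (s, a))

/-- The discounted return up to time `T` from the initial state distribution `p0`. -/
def discountedReturn (P : Kernel (ℝ × A) ℝ) (pol : Kernel ℝ A) (p0 : Measure ℝ) (γ : ℝ)
    (r : ℝ → A → ℝ → ℝ) (T : ℕ) : ℝ :=
  ∑ t ∈ Finset.range (T + 1), γ ^ t * ∫ s, expectedReward P pol r t s ∂p0

/-- The discounted return over the infinite horizon. -/
def discountedReturnInf (P : Kernel (ℝ × A) ℝ) (pol : Kernel ℝ A) (p0 : Measure ℝ) (γ : ℝ)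
    (r : ℝ → A → ℝ → ℝ) : ℝ :=
  ∑' t : ℕ, γ ^ t * ∫ s, expectedReward P pol r t s ∂p0

section Bellman

lemma abs_integral_le_const {β : Type*} [MeasurableSpace β] (μ : Measure β)
    [IsProbabilityMeasure μ] {g : β → ℝ} {K : ℝ} (h : ∀ x, |g x| ≤ K) : |∫ x, g x ∂μ| ≤ K := by
  have := norm_integral_le_of_norm_le_const (μ := μ) (f := g) (C := K) (ae_of_all _ h)
  simpa using this

lemma integral_discounted_tsum {β : Type*} [MeasurableSpace β] (μ : Measure β)
    [IsProbabilityMeasure μ] {γ K : ℝ} (hγ0 : 0 < γ) (hγ1 : γ < 1) (G : ℕ → β → ℝ)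
    (hG : ∀ t, Measurable (G t)) (hGb : ∀ t x, |G t x| ≤ K) :
    ∫ x, ∑' t, γ ^ t * G t x ∂μ = ∑' t, γ ^ t * ∫ x, G t x ∂μ := by
  have hgeo : Summable (fun t : ℕ => γ ^ t * K) :=
    (summable_geometric_of_lt_one hγ0.le hγ1).mul_right K
  have hint : ∀ t, Integrable (fun x => γ ^ t * G t x) μ := fun t =>
    (Integrable.of_bound (hG t).aestronglyMeasurable K (ae_of_all _ (hGb t))).const_mul _
  rw [← integral_tsum_of_summable_integral_norm hint]
  · simp_rw [integral_const_mul]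
  · refine Summable.of_nonneg_of_le (fun t => integral_nonneg fun _ => norm_nonneg _)
      (fun t => ?_) hgeo
    refine (integral_mono (hint t).norm (integrable_const (γ ^ t * K)) fun x => ?_).trans_eq
      (by simp)
    simp only [norm_mul, Real.norm_of_nonneg (pow_nonneg hγ0.le t)]
    exact mul_le_mul_of_nonneg_left (hGb t x) (pow_nonneg hγ0.le t)

variable {P : Kernel (ℝ × A) ℝ} [IsMarkovKernel P] {pol : Kernel ℝ A} [IsMarkovKernel pol]
  {γ : ℝ} {r : ℝ → A → ℝ → ℝ} {K : ℝ}

lemma measurable_expectedReward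
    (hr : Measurable (fun p : (ℝ × A) × ℝ => r p.1.1 p.1.2 p.2)) (t : ℕ) :
    Measurable (expectedReward P pol r t) := by
  have key : ∀ g : (ℝ × A) × ℝ → ℝ, Measurable g →
      Measurable (fun s => ∫ a, ∫ s', g ((s, a), s') ∂(P (s, a)) ∂(pol s)) := by
    intro g hg
    have h1 : StronglyMeasurable (fun x : ℝ × A => ∫ s', g (x, s') ∂(P x)) :=
      hg.stronglyMeasurable.integral_kernel_prod_right'
    exact (StronglyMeasurable.integral_kernel_prod_right' (κ := pol) h1).measurable
  cases t with
  | zero => exact key _ hr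
  | succ t =>
    exact key (fun p => expectedReward P pol r t p.2)
      ((measurable_expectedReward hr t).comp measurable_snd)

lemma abs_expectedReward_le (hK : ∀ s a s', |r s a s'| ≤ K) (t : ℕ) (s : ℝ) :
    |expectedReward P pol r t s| ≤ K := by
  have key : ∀ (g : A → ℝ → ℝ) (s : ℝ), (∀ a s', |g a s'| ≤ K) →
      |∫ a, ∫ s', g a s' ∂(P (s, a)) ∂(pol s)| ≤ K := by
    intro g s hg
    exact abs_integral_le_const _ fun a => abs_integral_le_const _ (hg a)
  induction t generalizing s with
  | zero => exact key _ s (hK s)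
  | succ t ih => exact key _ s fun _ s' => ih s'

/-- For a bounded measurable reward, the state-value function solves the Bellman equation. -/
lemma stateValue_bellman (hγ0 : 0 < γ) (hγ1 : γ < 1)
    (hr : Measurable (fun p : (ℝ × A) × ℝ => r p.1.1 p.1.2 p.2))
    (hK : ∀ s a s', |r s a s'| ≤ K) (s : ℝ) :
    stateValue P pol γ r s =
      ∫ a, ((∫ s', r s a s' ∂(P (s, a))) +
        γ * ∫ s', stateValue P pol γ r s' ∂(P (s, a))) ∂(pol s) := by
  have hm := measurable_expectedReward (P := P) (pol := pol) hr
  have hb := abs_expectedReward_le (P := P) (pol := pol) hK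
  have hgeo : Summable (fun t : ℕ => γ ^ t * K) :=
    (summable_geometric_of_lt_one hγ0.le hγ1).mul_right K
  have hsum : ∀ s, Summable (fun t => γ ^ t * expectedReward P pol r t s) := fun s =>
    Summable.of_norm_bounded hgeo fun t => by
      rw [norm_mul, Real.norm_of_nonneg (pow_nonneg hγ0.le t)]
      exact mul_le_mul_of_nonneg_left (hb t s) (pow_nonneg hγ0.le t)
  -- measurability and bounds of the inner averages
  have hmi : ∀ t, Measurable (fun x : ℝ × A => ∫ s', expectedReward P pol r t s' ∂(P x)) :=
    fun t => (StronglyMeasurable.integral_kernel_prod_right' (κ := P)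
      ((hm t).comp measurable_snd).stronglyMeasurable).measurable
  have hbi : ∀ t x, |∫ s', expectedReward P pol r t s' ∂(P x)| ≤ K := fun t x =>
    abs_integral_le_const _ (hb t)
  have hinner : ∀ a, ∫ s', stateValue P pol γ r s' ∂(P (s, a)) =
      ∑' t, γ ^ t * ∫ s', expectedReward P pol r t s' ∂(P (s, a)) := fun a =>
    integral_discounted_tsum (P (s, a)) hγ0 hγ1 _ hm hb
  have hr1 : Integrable (fun a => ∫ s', r s a s' ∂(P (s, a))) (pol s) := by
    have h1 : StronglyMeasurable (fun x : ℝ × A => ∫ s', r x.1 x.2 s' ∂(P x)) :=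
      hr.stronglyMeasurable.integral_kernel_prod_right'
    refine Integrable.of_bound
      (h1.measurable.comp (measurable_const.prodMk measurable_id)).aestronglyMeasurable K
      (ae_of_all _ fun a => abs_integral_le_const _ (hK s a))
  have hGm : ∀ t, Measurable (fun a => ∫ s', expectedReward P pol r t s' ∂(P (s, a))) :=
    fun t => (hmi t).comp (measurable_const.prodMk measurable_id)
  have hr2 : Integrable
      (fun a => ∑' t, γ ^ t * ∫ s', expectedReward P pol r t s' ∂(P (s, a))) (pol s) := by
    have hmeas : Measurable
        (fun a => ∑' t, γ ^ t * ∫ s', expectedReward P pol r t s' ∂(P (s, a))) :=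
      Measurable.tsum fun t => (hGm t).const_mul _
    refine Integrable.of_bound hmeas.aestronglyMeasurable (∑' t : ℕ, γ ^ t * K)
      (ae_of_all _ fun a => ?_)
    refine tsum_of_norm_bounded hgeo.hasSum fun t => ?_
    rw [norm_mul, Real.norm_of_nonneg (pow_nonneg hγ0.le t)]
    exact mul_le_mul_of_nonneg_left (hbi t (s, a)) (pow_nonneg hγ0.le t)
  simp_rw [hinner]
  rw [integral_add hr1 (hr2.const_mul γ), integral_const_mul, 
    integral_discounted_tsum (pol s) hγ0 hγ1 _ hGm
    (fun t a => hbi t (s, a)), stateValue, (hsum s).tsum_eq_zero_add, ← tsum_mul_left]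
  simp only [pow_zero, one_mul, expectedReward, pow_succ']
  simp only [mul_assoc]

end Bellman

end Values

/-- Rewards of the original MDP. -/
def extrinsicReward {A : Type*} (re : ℝ → A → ℝ) : ℝ → A → ℝ → ℝ := fun s a _ => re s a

/-- Rewards of the BAMDP at the belief formed from the data `D`:
`r^e(s, a) + η * IG_θ(s, a, s')`. -/
def augmentedReward {A Θ : Type*} [MeasurableSpace A] [MeasurableSpace Θ]
    (M : GaussianDynamics A Θ) (prior lam : Measure Θ) (re : ℝ → A → ℝ) (η : ℝ) {n : ℕ}
    (D : Fin n → Transition A) : ℝ → A → ℝ → ℝ :=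
  fun s a s' => re s a + η * infoGain M prior lam D s a s'

/-- Convergence in probability of `Y n`, defined on the probability space `(X n, P n)`, to the
constant `y`. -/
def TendstoInProb {X : ℕ → Type*} [∀ n, MeasurableSpace (X n)] (P : (n : ℕ) → Measure (X n))
    (Y : (n : ℕ) → X n → ℝ) (y : ℝ) : Prop :=
  ∀ ε : ℝ, 0 < ε → Tendsto (fun n => P n {x | ε ≤ |Y n x - y|}) atTop (𝓝 0)

end InfoGain

end

open InfoGain

noncomputable section

namespace InfoGain

/-! ### Kullback-Leibler divergence and lower tails of density ratios -/

section KullbackLeibler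

variable {X : Type*} [MeasurableSpace X]

/-! Values are discounted sums of expected rewards, so the gap between the BAMDP and MDP values is
at most the integral, against a finite discounted occupation measure, of the error of the one-step
mean reward. At a fixed pair `(s, a)` this error is almost surely `|η|` times the absolute mean of
the information gain under the true dynamics. By dominated convergence and Markov's inequality
(`tendstoInProb_of_enorm_sub_le`) it suffices that this mean tends to zero in L¹ of the data law for
each fixed pair: `tendsto_lintegral_enorm_integral_infoGain`.

Fix data with posterior `q`, let `g_θ` be the transition density and `ḡ` its `q`-mixture. Averaged
under the predictive law `ḡ`, the information gain is the mutual information `I` of parameter and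
observation (`enorm_integral_mixture_mul`). Passing from `ḡ` to `g_θ₀` costs `∫ |IG| |g_θ₀ - ḡ|`,
which a Cauchy-Schwarz argument bounds by the second moments of the gain and a Hellinger distance.
The compensation inequality `I + D(ḡ ‖ m) ≤ ∫ D(g_θ ‖ m) dq` (`mutualInfo_add_le`) controls both `I`
and that distance, for any positive `m`.

The choice of `m` is the crux. With `m = g_θ₀` the right side may be dominated by remote parameters,
where `D(g_θ ‖ g_θ₀)` need not be bounded or prior-integrable. Instead `m = g_θ₀ + α ḡ_prior`
(`lintegral_relEnt_contaminated_le`). Near `θ₀` the divergence is small by Gaussian continuity;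
elsewhere it is at most `k(θ) = D(g_θ ‖ ḡ_prior) + 1 + log (1/α)`. This weight is prior-integrable:
the moment bound for the empty data set forces the mutual information under the prior to be finite.

It remains that the posterior integral of a fixed prior-integrable weight outside a ball around `θ₀`
tends to zero in probability (`tendsto_measure_posterior_far`). This is Schwartz's theorem with a
weight: KL support keeps the evidence relative to the truth above `c exp (-bn/2)` with high
probability, while the tests make the weighted numerator of order `exp (-bn)`. -/

lemma klDiv_withDensity_right (μ : Measure X) [IsFiniteMeasure μ] {R : X → ℝ≥0∞}
    (hR : Measurable R) (h0 : ∀ x, R x ≠ 0) (ht : ∀ x, R x ≠ ∞)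
    [IsFiniteMeasure (μ.withDensity R)] :
    InformationTheory.klDiv μ (μ.withDensity R) =
      ∫⁻ x, R x * ENNReal.ofReal (InformationTheory.klFun (R x)⁻¹.toReal) ∂μ := by
  have hinv : (μ.withDensity R).withDensity (fun x => (R x)⁻¹) = μ :=
    withDensity_inv_same hR (ae_of_all _ h0) (ae_of_all _ ht)
  have hac : μ ≪ μ.withDensity R := withDensity_absolutelyContinuous' hR.aemeasurable
    (ae_of_all _ h0)
  have hd : μ.rnDeriv (μ.withDensity R) =ᵐ[μ.withDensity R] fun x => (R x)⁻¹ := by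
    have := Measure.rnDeriv_withDensity (μ.withDensity R) hR.inv
    rwa [show (μ.withDensity R).withDensity R⁻¹ = μ from hinv] at this
  rw [InformationTheory.klDiv_eq_lintegral_klFun_of_ac hac]
  have : ∫⁻ x, ENNReal.ofReal (InformationTheory.klFun
      (μ.rnDeriv (μ.withDensity R) x).toReal) ∂(μ.withDensity R) =
      ∫⁻ x, ENNReal.ofReal (InformationTheory.klFun (R x)⁻¹.toReal) ∂(μ.withDensity R) :=
    lintegral_congr_ae (hd.mono fun x hx => by simp only [hx])
  rw [this, lintegral_withDensity_eq_lintegral_mul _ hR]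
  · rfl
  · exact (InformationTheory.measurable_klFun.comp hR.inv.ennreal_toReal).ennreal_ofReal

/-- Markov's inequality for the nonnegative integrand `R * klFun (1/R) = -log R + R - 1`, which
exceeds `t - 1` where `R < exp (-t)`. The nonnegative form avoids any integrability of `log R`; the
price is the lost `1`. -/
lemma sub_one_mul_measure_le_klDiv (μ : Measure X) [IsFiniteMeasure μ] {R : X → ℝ≥0∞}
    (hR : Measurable R) (h0 : ∀ x, R x ≠ 0) (ht : ∀ x, R x ≠ ∞)
    [IsFiniteMeasure (μ.withDensity R)] (t : ℝ) :
    ENNReal.ofReal (t - 1) * μ {x | R x < ENNReal.ofReal (Real.exp (-t))} ≤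
      InformationTheory.klDiv μ (μ.withDensity R) := by
  rw [klDiv_withDensity_right μ hR h0 ht]
  have hm : Measurable fun x =>
      R x * ENNReal.ofReal (InformationTheory.klFun (R x)⁻¹.toReal) :=
    hR.mul (InformationTheory.measurable_klFun.comp hR.inv.ennreal_toReal).ennreal_ofReal
  refine le_trans ?_ (mul_meas_ge_le_lintegral₀ hm.aemeasurable (ENNReal.ofReal (t - 1)))
  gcongr with x
  intro hx
  have hpos : 0 < (R x).toReal := ENNReal.toReal_pos (h0 x) (ht x)
  have hlt : (R x).toReal < Real.exp (-t) := by
    rwa [← ENNReal.ofReal_toReal (ht x), ENNReal.ofReal_lt_ofReal_iff (Real.exp_pos _)] at hx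
  have hlog : Real.log (R x).toReal < -t := by
    rwa [Real.log_lt_iff_lt_exp hpos]
  nth_rw 1 [← ENNReal.ofReal_toReal (ht x)]
  rw [← ENNReal.ofReal_mul hpos.le]
  apply ENNReal.ofReal_le_ofReal
  rw [InformationTheory.klFun_apply, ENNReal.toReal_inv, Real.log_inv]
  have : (R x).toReal * ((R x).toReal⁻¹ * -Real.log (R x).toReal + 1 - (R x).toReal⁻¹) =
      -Real.log (R x).toReal + (R x).toReal - 1 := by
    field_simp
  rw [this]; linarith

end KullbackLeibler

/-! ### Lower bounds for the evidence -/

section Evidence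

variable {X Θ : Type*} [MeasurableSpace X] [MeasurableSpace Θ]

/-- If most of the likelihood ratios over a set `S` of parameters are not small, then neither is
the evidence. -/
lemma measure_evidence_lt_le (μ : Measure X) [IsFiniteMeasure μ] (prior : Measure Θ)
    [IsFiniteMeasure prior] {R : X → Θ → ℝ≥0∞} (hR : Measurable (Function.uncurry R))
    {S : Set Θ} (hS : MeasurableSet S) (hS0 : prior S ≠ 0) (c p : ℝ≥0∞)
    (h : ∀ θ ∈ S, μ {x | R x θ < c} ≤ p) :
    μ {x | ∫⁻ θ, R x θ ∂prior < c * (prior S / 2)} ≤ 2 * p := by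
  set B : Set (X × Θ) := {z | z.2 ∈ S ∧ R z.1 z.2 < c} with hB
  have hBm : MeasurableSet B :=
    (measurable_snd hS).inter (measurableSet_lt hR measurable_const)
  have hbm : Measurable fun x => prior (Prod.mk x ⁻¹' B) := measurable_measure_prodMk_left hBm
  -- If less than half of the prior mass of `S` had ratio below `c`, the rest of `S` alone would
  -- contribute `c * (prior S / 2)` to the evidence.
  have hsub : {x | ∫⁻ θ, R x θ ∂prior < c * (prior S / 2)} ⊆
      {x | prior S / 2 ≤ prior (Prod.mk x ⁻¹' B)} := by
    intro x hx
    by_contra hlt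
    simp only [Set.mem_ofPred_eq, not_le] at hx hlt
    refine hx.not_ge ?_
    have hm : MeasurableSet {θ | c ≤ R x θ} :=
      measurableSet_le measurable_const (hR.comp measurable_prodMk_left)
    have h1 : prior S ≤ prior S / 2 + prior {θ | c ≤ R x θ} := by
      calc prior S ≤ prior (Prod.mk x ⁻¹' B ∪ {θ | c ≤ R x θ}) := by
            apply measure_mono
            intro θ hθ
            by_cases hc : c ≤ R x θ
            · exact Or.inr hc
            · exact Or.inl ⟨hθ, not_le.mp hc⟩
        _ ≤ _ := measure_union_le _ _
        _ ≤ _ := by gcongr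
    have h2 : prior S / 2 ≤ prior {θ | c ≤ R x θ} := by
      have hnt : prior S / 2 ≠ ∞ := ENNReal.div_ne_top (measure_ne_top _ _) (by simp)
      exact (ENNReal.add_le_add_iff_left hnt).mp (by rwa [ENNReal.add_halves])
    calc c * (prior S / 2) ≤ c * prior {θ | c ≤ R x θ} := by gcongr
      _ ≤ _ := mul_meas_ge_le_lintegral₀ (hR.comp measurable_prodMk_left).aemeasurable c
  refine (measure_mono hsub).trans ?_
  -- Tonelli: the expected prior mass of the bad part of `S` is at most `p * prior S`, so by Markov
  -- it exceeds half of `prior S` with probability at most `2 * p`.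
  have hint : ∫⁻ x, prior (Prod.mk x ⁻¹' B) ∂μ ≤ p * prior S := by
    rw [← Measure.prod_apply hBm, Measure.prod_apply_symm hBm]
    calc ∫⁻ θ, μ ((fun x => (x, θ)) ⁻¹' B) ∂prior ≤ ∫⁻ θ, S.indicator (fun _ => p) θ ∂prior := by
          apply lintegral_mono
          intro θ
          by_cases hθ : θ ∈ S
          · simp only [hθ, Set.indicator_of_mem]
            refine (measure_mono ?_).trans (h θ hθ)
            intro x hx; exact hx.2
          · have : (fun x : X => (x, θ)) ⁻¹' B = ∅ := by
              ext x; simp [hB, hθ]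
            simp [this]
      _ = p * prior S := by rw [lintegral_indicator hS]; simp
  have hne : prior S / 2 ≠ 0 := by simp [hS0]
  have hnt : prior S / 2 ≠ ∞ := ENNReal.div_ne_top (measure_ne_top _ _) (by simp)
  have hmk := (mul_meas_ge_le_lintegral₀ (μ := μ) hbm.aemeasurable (prior S / 2)).trans hint
  have : prior S / 2 * μ {x | prior S / 2 ≤ prior (Prod.mk x ⁻¹' B)} ≤
      prior S / 2 * (2 * p) := by
    refine hmk.trans (le_of_eq ?_)
    rw [← mul_assoc, ENNReal.div_mul_cancel (by simp) (by simp), mul_comm]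
  exact (ENNReal.mul_le_mul_iff_right hne hnt).mp this

end Evidence

/-! ### Likelihood ratios, change of measure and the posterior -/

section DataLaw

variable {A Θ : Type*} [MeasurableSpace A] [MeasurableSpace Θ] (M : GaussianDynamics A Θ)
  (prior : Measure Θ) (ρ : (n : ℕ) → Kernel (Fin n → Transition A) (ℝ × A))

lemma trans_eq_withDensity (θ : Θ) (x : ℝ × A) :
    M.trans θ x = volume.withDensity (gaussianPDF (M.mean θ x) (M.var θ)) :=
  gaussianReal_of_var_ne_zero _ (M.var_pos θ).ne'

lemma measurable_density :
    Measurable fun p : Θ × Transition A => gaussianPDF (M.mean p.1 p.2.1) (M.var p.1) p.2.2 :=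
  measurable_uncurry_gaussianPDF.comp
    ((M.measurable_mean.comp (measurable_fst.prodMk measurable_snd.fst)).prodMk
      ((M.measurable_var.comp measurable_fst).prodMk measurable_snd.snd))

lemma density_ne_zero (θ : Θ) (x : ℝ × A) (y : ℝ) : gaussianPDF (M.mean θ x) (M.var θ) y ≠ 0 :=
  (gaussianPDF_pos _ (M.var_pos θ).ne' y).ne'

lemma measurable_likelihood (n : ℕ) :
    Measurable fun p : (Fin n → Transition A) × Θ => likelihood M p.1 p.2 := by
  unfold likelihood
  refine Finset.measurable_prod _ fun i _ => ?_
  exact (measurable_density M).comp (measurable_snd.prodMk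
    ((measurable_pi_apply i).comp measurable_fst))

lemma measurable_likelihood_right {n : ℕ} (D : Fin n → Transition A) :
    Measurable (likelihood M D) :=
  Measurable.comp (g := fun p : (Fin n → Transition A) × Θ => likelihood M p.1 p.2)
    (f := fun θ => (D, θ)) (measurable_likelihood M n) measurable_prodMk_left

lemma likelihood_ne_zero {n : ℕ} (D : Fin n → Transition A) (θ : Θ) : likelihood M D θ ≠ 0 :=
  Finset.prod_ne_zero_iff.mpr fun _ _ => density_ne_zero M _ _ _

lemma likelihood_ne_top {n : ℕ} (D : Fin n → Transition A) (θ : Θ) : likelihood M D θ ≠ ∞ :=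
  ENNReal.prod_ne_top fun _ _ => gaussianPDF_ne_top

lemma likelihood_snoc {n : ℕ} (D : Fin n → Transition A) (z : Transition A) (θ : Θ) :
    likelihood M (Fin.snoc D z : Fin (n + 1) → Transition A) θ =
      likelihood M D θ * gaussianPDF (M.mean θ z.1) (M.var θ) z.2 := by
  simp [likelihood, Fin.prod_univ_castSucc]

/-- The likelihood ratio of `θ` against `θ₀`. -/
def likelihoodRatio (θ₀ : Θ) {n : ℕ} (D : Fin n → Transition A) (θ : Θ) : ℝ≥0∞ :=
  likelihood M D θ * (likelihood M D θ₀)⁻¹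

lemma measurable_likelihoodRatio (θ₀ : Θ) (n : ℕ) :
    Measurable fun p : (Fin n → Transition A) × Θ => likelihoodRatio M θ₀ p.1 p.2 :=
  (measurable_likelihood M n).mul
    ((measurable_likelihood M n).comp (measurable_fst.prodMk measurable_const)).inv

lemma measurable_likelihoodRatio_left (θ₀ θ : Θ) (n : ℕ) :
    Measurable fun D : Fin n → Transition A => likelihoodRatio M θ₀ D θ :=
  Measurable.comp (g := fun p : (Fin n → Transition A) × Θ => likelihoodRatio M θ₀ p.1 p.2)
    (f := fun D => (D, θ)) (measurable_likelihoodRatio M θ₀ n) measurable_prodMk_right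

lemma likelihoodRatio_ne_zero (θ₀ : Θ) {n : ℕ} (D : Fin n → Transition A) (θ : Θ) :
    likelihoodRatio M θ₀ D θ ≠ 0 :=
  mul_ne_zero (likelihood_ne_zero M D θ) (ENNReal.inv_ne_zero.mpr (likelihood_ne_top M D θ₀))

lemma likelihoodRatio_ne_top (θ₀ : Θ) {n : ℕ} (D : Fin n → Transition A) (θ : Θ) :
    likelihoodRatio M θ₀ D θ ≠ ∞ :=
  ENNReal.mul_ne_top (likelihood_ne_top M D θ) (ENNReal.inv_ne_top.mpr (likelihood_ne_zero M D θ₀))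

variable [∀ n, IsMarkovKernel (ρ n)]

lemma lintegral_dataLaw_succ (θ : Θ) (n : ℕ) {F : (Fin (n + 1) → Transition A) → ℝ≥0∞}
    (hF : Measurable F) :
    ∫⁻ D, F D ∂(dataLaw M ρ θ (n + 1)) =
      ∫⁻ D, ∫⁻ x, ∫⁻ y, gaussianPDF (M.mean θ x) (M.var θ) y *
        F (Fin.snoc D (x, y) : Fin (n + 1) → Transition A) ∂volume ∂(ρ n D)
        ∂(dataLaw M ρ θ n) := by
  have hg : Measurable fun p : (Fin n → Transition A) × Transition A =>
      F (Fin.snoc p.1 p.2 : Fin (n + 1) → Transition A) := hF.comp (measurable_snoc n)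
  rw [dataLaw, lintegral_map hF (measurable_snoc n), Measure.lintegral_compProd hg]
  refine lintegral_congr fun D => ?_
  rw [Kernel.lintegral_compProd (f := fun b => F (Fin.snoc D b : Fin (n + 1) → Transition A)) _ _ _
    (hg.comp measurable_prodMk_left)]
  refine lintegral_congr fun x => ?_
  rw [Kernel.prodMkLeft_apply, trans_eq_withDensity, lintegral_withDensity_eq_lintegral_mul _
    (measurable_gaussianPDF _ _)]
  · rfl
  · exact hg.comp (measurable_const.prodMk (measurable_const.prodMk measurable_id))

/-- The sampling rule does not depend on the parameter, so it cancels: each new observation only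
multiplies the ratio of the data laws by a quotient of two Gaussian densities, which are positive
and finite everywhere. -/
lemma lintegral_dataLaw (θ₀ θ : Θ) (n : ℕ) {F : (Fin n → Transition A) → ℝ≥0∞}
    (hF : Measurable F) :
    ∫⁻ D, F D ∂(dataLaw M ρ θ n) =
      ∫⁻ D, likelihoodRatio M θ₀ D θ * F D ∂(dataLaw M ρ θ₀ n) := by
  induction n with
  | zero => simp [dataLaw, likelihoodRatio, likelihood]
  | succ n ih =>
    have hR : Measurable fun D => likelihoodRatio M θ₀ (n := n + 1) D θ :=
      measurable_likelihoodRatio_left M θ₀ θ (n + 1)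
    rw [lintegral_dataLaw_succ M ρ θ n hF, 
      lintegral_dataLaw_succ M ρ θ₀ n
        (F := fun D => likelihoodRatio M θ₀ (n := n + 1) D θ * F D) (hR.mul hF), ih]
    · refine lintegral_congr fun D => ?_
      rw [← lintegral_const_mul' _ _ (likelihoodRatio_ne_top M θ₀ D θ)]
      refine lintegral_congr fun x => ?_
      rw [← lintegral_const_mul' _ _ (likelihoodRatio_ne_top M θ₀ D θ)]
      refine lintegral_congr fun y => ?_
      simp only [likelihoodRatio, likelihood_snoc]
      rw [ENNReal.mul_inv (Or.inl (likelihood_ne_zero M D θ₀))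
        (Or.inl (likelihood_ne_top M D θ₀))]
      have := ENNReal.mul_inv_cancel (density_ne_zero M θ₀ x y)
        (gaussianPDF_ne_top (μ := M.mean θ₀ x) (v := M.var θ₀) (x := y))
      set g := gaussianPDF (M.mean θ₀ x) (M.var θ₀) y
      calc _ = likelihood M D θ * (likelihood M D θ₀)⁻¹ *
              (gaussianPDF (M.mean θ x) (M.var θ) y *
              F (Fin.snoc D (x, y) : Fin (n + 1) → Transition A)) * 1 := by rw [mul_one]
        _ = _ := by rw [← this]; ring
    · have hm : Measurable fun p : ((Fin n → Transition A) × (ℝ × A)) × ℝ =>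
          gaussianPDF (M.mean θ p.1.2) (M.var θ) p.2 *
            F (Fin.snoc p.1.1 (p.1.2, p.2) : Fin (n + 1) → Transition A) := by
        refine Measurable.mul ?_ ?_
        · exact (measurable_density M).comp (measurable_const.prodMk
            (measurable_fst.snd.prodMk measurable_snd))
        · exact (hF.comp (measurable_snoc n)).comp (measurable_fst.fst.prodMk
            (measurable_fst.snd.prodMk measurable_snd))
      exact (hm.lintegral_prod_right').lintegral_kernel_prod_right'

lemma dataLaw_eq_withDensity (θ₀ θ : Θ) (n : ℕ) :
    dataLaw M ρ θ n = (dataLaw M ρ θ₀ n).withDensity (fun D => likelihoodRatio M θ₀ D θ) := by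
  ext s hs
  rw [withDensity_apply _ hs, ← lintegral_indicator hs, ← lintegral_indicator_one hs,
    lintegral_dataLaw M ρ θ₀ θ n (measurable_one.indicator hs)]
  refine lintegral_congr fun D => ?_
  by_cases h : D ∈ s <;> simp [h]

lemma lintegral_likelihoodRatio (θ₀ θ : Θ) (n : ℕ) :
    ∫⁻ D, likelihoodRatio M θ₀ D θ ∂(dataLaw M ρ θ₀ n) = 1 := by
  have := lintegral_dataLaw M ρ θ₀ θ n (F := fun _ => 1) measurable_const
  simpa using this.symm

/-- The evidence `∫ p(D | θ) p(dθ)`. -/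
def evidence {n : ℕ} (D : Fin n → Transition A) : ℝ≥0∞ := ∫⁻ θ, likelihood M D θ ∂prior

lemma measurable_evidence [SFinite prior] (n : ℕ) :
    Measurable fun D : Fin n → Transition A => evidence M prior D :=
  (measurable_likelihood M n).lintegral_prod_right'

lemma evidence_ne_zero [NeZero prior] {n : ℕ} (D : Fin n → Transition A) :
    evidence M prior D ≠ 0 := by
  intro h
  rw [evidence, lintegral_eq_zero_iff (measurable_likelihood_right M D)] at h
  refine NeZero.ne prior (Measure.measure_univ_eq_zero.mp ?_)
  refine measure_mono_null ?_ (ae_iff.mp h)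
  intro θ _ ; exact likelihood_ne_zero M D θ

/-- Under `θ₀` each likelihood ratio has mean one, hence so has its prior average. Pointwise the
evidence may be infinite, since Gaussian densities are unbounded as the variance shrinks;
`bayesPosterior` is then the zero measure because `∞⁻¹ = 0`. -/
lemma ae_evidence_ne_top [IsProbabilityMeasure prior] (θ₀ : Θ) (n : ℕ) :
    ∀ᵐ D ∂(dataLaw M ρ θ₀ n), evidence M prior D ≠ ∞ := by
  have hm := measurable_likelihoodRatio M θ₀ n
  have h1 : ∫⁻ D, ∫⁻ θ, likelihoodRatio M θ₀ D θ ∂prior ∂(dataLaw M ρ θ₀ n) = 1 := by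
    rw [lintegral_lintegral_swap hm.aemeasurable]
    simp [lintegral_likelihoodRatio M ρ θ₀]
  filter_upwards [ae_lt_top hm.lintegral_prod_right' (by rw [h1]; simp)] with D hD htop
  have : ∫⁻ θ, likelihoodRatio M θ₀ D θ ∂prior = evidence M prior D * (likelihood M D θ₀)⁻¹ := by
    simp only [likelihoodRatio]
    rw [lintegral_mul_const' _ _ (ENNReal.inv_ne_top.mpr (likelihood_ne_zero M D θ₀))]; rfl
  rw [this, htop, ENNReal.top_mul (ENNReal.inv_ne_zero.mpr (likelihood_ne_top M D θ₀))] at hD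
  exact lt_irrefl _ hD

lemma bayesPosterior_eq {n : ℕ} (D : Fin n → Transition A) :
    bayesPosterior M prior D =
      prior.withDensity (fun θ => (evidence M prior D)⁻¹ * likelihood M D θ) := by
  rw [bayesPosterior, ← withDensity_smul _ (measurable_likelihood_right M D)]
  rfl

lemma lintegral_bayesPosterior {n : ℕ} (D : Fin n → Transition A) {F : Θ → ℝ≥0∞}
    (hF : Measurable F) :
    ∫⁻ θ, F θ ∂(bayesPosterior M prior D) =
      (evidence M prior D)⁻¹ * ∫⁻ θ, likelihood M D θ * F θ ∂prior := by
  rw [bayesPosterior, lintegral_smul_measure, lintegral_withDensity_eq_lintegral_mul _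
    (measurable_likelihood_right M D) hF]
  rfl

lemma isProbabilityMeasure_bayesPosterior [NeZero prior] {n : ℕ} (D : Fin n → Transition A)
    (h : evidence M prior D ≠ ∞) : IsProbabilityMeasure (bayesPosterior M prior D) := by
  constructor
  rw [bayesPosterior, Measure.smul_apply, withDensity_apply _ MeasurableSet.univ,
    Measure.restrict_univ]
  exact ENNReal.inv_mul_cancel (evidence_ne_zero M prior D) h

end DataLaw

/-! ### Posterior consistency with an integrable weight -/

section Consistency

variable {A Θ : Type*} [MeasurableSpace A] [MeasurableSpace Θ] (M : GaussianDynamics A Θ)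
  (prior : Measure Θ) (ρ : (n : ℕ) → Kernel (Fin n → Transition A) (ℝ × A))
  [∀ n, IsMarkovKernel (ρ n)]

/-- Makes the Kullback-Leibler neighbourhoods of `KLSupport` measurable, as the Tonelli argument for
the evidence requires. -/
lemma measurable_klDiv_dataLaw (θ₀ : Θ) (n : ℕ) :
    Measurable fun θ => InformationTheory.klDiv (dataLaw M ρ θ₀ n) (dataLaw M ρ θ n) := by
  have hR := measurable_likelihoodRatio M θ₀ n
  have : ∀ θ, InformationTheory.klDiv (dataLaw M ρ θ₀ n) (dataLaw M ρ θ n) =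
      ∫⁻ D, likelihoodRatio M θ₀ D θ * ENNReal.ofReal
        (InformationTheory.klFun (likelihoodRatio M θ₀ D θ)⁻¹.toReal) ∂(dataLaw M ρ θ₀ n) := by
    intro θ
    have hd := dataLaw_eq_withDensity M ρ θ₀ θ n
    have : IsFiniteMeasure ((dataLaw M ρ θ₀ n).withDensity
      (fun D => likelihoodRatio M θ₀ D θ)) := hd ▸ inferInstance
    rw [hd, klDiv_withDensity_right _ (measurable_likelihoodRatio_left M θ₀ θ n)
      (fun D => likelihoodRatio_ne_zero M θ₀ D θ) (fun D => likelihoodRatio_ne_top M θ₀ D θ)]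
  simp_rw [this]
  exact (hR.mul (InformationTheory.measurable_klFun.comp
    hR.inv.ennreal_toReal).ennreal_ofReal).lintegral_prod_left'

lemma measure_likelihoodRatio_lt_le (θ₀ θ : Θ) (n : ℕ) (t : ℝ) :
    ENNReal.ofReal (t - 1) *
      dataLaw M ρ θ₀ n {D | likelihoodRatio M θ₀ D θ < ENNReal.ofReal (Real.exp (-t))} ≤
      InformationTheory.klDiv (dataLaw M ρ θ₀ n) (dataLaw M ρ θ n) := by
  have hd := dataLaw_eq_withDensity M ρ θ₀ θ n
  have : IsFiniteMeasure ((dataLaw M ρ θ₀ n).withDensity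
    (fun D => likelihoodRatio M θ₀ D θ)) := hd ▸ inferInstance
  rw [hd]
  exact sub_one_mul_measure_le_klDiv _ (measurable_likelihoodRatio_left M θ₀ θ n)
    (fun D => likelihoodRatio_ne_zero M θ₀ D θ) (fun D => likelihoodRatio_ne_top M θ₀ D θ) t

/-- Under Kullback-Leibler support, the evidence relative to the truth does not decay at a given
exponential rate, with high probability. -/
lemma KLSupport.eventually_evidence [IsFiniteMeasure prior] {θ₀ : Θ}
    (hKL : KLSupport M prior ρ θ₀) {b : ℝ} (hb : 0 < b) {e : ℝ} (he : 0 < e) :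
    ∃ c : ℝ≥0∞, c ≠ 0 ∧ c ≠ ∞ ∧ ∀ᶠ n : ℕ in atTop,
      dataLaw M ρ θ₀ n {D | ∫⁻ θ, likelihoodRatio M θ₀ D θ ∂prior <
        ENNReal.ofReal (Real.exp (-(b * n))) * c} ≤ ENNReal.ofReal e := by
  -- Once `n * b > 2` one has `b * n - 1 ≥ b * n / 2`, so `n * ε ≤ (b * n - 1) * (e / 2)`. Each
  -- ratio over `S` is then below `exp (-(b * n))` with probability at most `e / 2`, and the
  -- evidence bound doubles this to `e`.
  set ε : ℝ := b * e / 4 with hε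
  have hε0 : 0 < ε := by positivity
  set S : Set Θ := {θ | ∀ n : ℕ, InformationTheory.klDiv (dataLaw M ρ θ₀ n) (dataLaw M ρ θ n)
      ≤ ENNReal.ofReal (n * ε)} with hS
  have hSm : MeasurableSet S := by
    have : S = ⋂ n : ℕ, {θ | InformationTheory.klDiv (dataLaw M ρ θ₀ n) (dataLaw M ρ θ n)
      ≤ ENNReal.ofReal (n * ε)} := by ext; simp [hS]
    rw [this]
    exact MeasurableSet.iInter fun n =>
      measurableSet_le (measurable_klDiv_dataLaw M ρ θ₀ n) measurable_const
  have hS0 : prior S ≠ 0 := (hKL ε hε0).ne'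
  refine ⟨prior S / 2, by simp [hS0], ENNReal.div_ne_top (measure_ne_top _ _) (by simp), ?_⟩
  obtain ⟨N, hN⟩ := exists_nat_gt (2 / b)
  filter_upwards [eventually_ge_atTop (N + 1)] with n hn
  have hn0 : (0 : ℝ) < n := by
    have : 1 ≤ n := by omega
    exact_mod_cast this
  have hnb : 2 < n * b := by
    rw [div_lt_iff₀ hb] at hN
    have : (N : ℝ) ≤ n := by exact_mod_cast (by omega : N ≤ n)
    nlinarith
  have key := measure_evidence_lt_le (dataLaw M ρ θ₀ n) prior
    (R := fun D θ => likelihoodRatio M θ₀ D θ) (measurable_likelihoodRatio M θ₀ n) hSm hS0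
    (ENNReal.ofReal (Real.exp (-(b * n)))) (ENNReal.ofReal (e / 2)) ?_
  · refine key.trans (le_of_eq ?_)
    rw [show (2 : ℝ≥0∞) = ENNReal.ofReal 2 by simp, ← ENNReal.ofReal_mul (by norm_num)]
    congr 1; ring
  · intro θ hθ
    have h1 := (measure_likelihoodRatio_lt_le M ρ θ₀ θ n (b * n)).trans (hθ n)
    have hpos : 0 < b * n - 1 := by nlinarith
    have h2 : ENNReal.ofReal (n * ε) ≤ ENNReal.ofReal (b * n - 1) * ENNReal.ofReal (e / 2) := by
      rw [← ENNReal.ofReal_mul hpos.le]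
      apply ENNReal.ofReal_le_ofReal
      rw [hε]; nlinarith
    exact (ENNReal.mul_le_mul_iff_right (by simpa using hpos) ENNReal.ofReal_ne_top).mp
      (h1.trans h2)

/-- Posterior consistency with an integrable weight: the `k`-weighted posterior mass of the
complement of a ball around the truth tends to zero in probability. -/
theorem tendsto_measure_posterior_far [PseudoMetricSpace Θ] [OpensMeasurableSpace Θ]
    [IsProbabilityMeasure prior] {θ₀ : Θ} (hKL : KLSupport M prior ρ θ₀)
    (htest : Testable M ρ θ₀) {k : Θ → ℝ≥0∞} (hk : Measurable k) (hki : ∫⁻ θ, k θ ∂prior ≠ ∞)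
    {r : ℝ} (hr : 0 < r) {δ : ℝ} (hδ : 0 < δ) :
    Tendsto (fun n => dataLaw M ρ θ₀ n {D | ENNReal.ofReal δ ≤
      ∫⁻ θ in {θ | r < dist θ θ₀}, k θ ∂(bayesPosterior M prior D)}) atTop (𝓝 0) := by
  obtain ⟨φ, hφm, hφ01, b, B, hb, hB, hφ⟩ := htest r hr
  have hfar : MeasurableSet {θ | r < dist θ θ₀} :=
    (isOpen_lt continuous_const (continuous_id.dist continuous_const)).measurableSet
  set F : Θ → ℝ≥0∞ := {θ | r < dist θ θ₀}.indicator k with hF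
  have hFm : Measurable F := hk.indicator hfar
  set K := ∫⁻ θ, k θ ∂prior with hK
  -- `u` is the square root of the exponential rate of the tests: the numerator is of order `u ^ 2`,
  -- the evidence at least of order `u`, and one factor `u` remains.
  set u : ℕ → ℝ≥0∞ := fun n => ENNReal.ofReal (Real.exp (-(b / 2 * n))) with hu
  have hu0 : ∀ n, u n ≠ 0 := fun n => by simp [hu, Real.exp_pos]
  have hut : ∀ n, u n ≠ ∞ := fun n => ENNReal.ofReal_ne_top
  have huu : ∀ n : ℕ, ENNReal.ofReal (B * Real.exp (-b * n)) = ENNReal.ofReal B * (u n * u n) := by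
    intro n
    rw [hu, ← ENNReal.ofReal_mul (Real.exp_pos _).le, ← ENNReal.ofReal_mul hB.le, ← Real.exp_add]
    congr 3; ring
  have hulim : Tendsto u atTop (𝓝 0) := by
    rw [← ENNReal.ofReal_zero]
    refine ENNReal.tendsto_ofReal (Real.tendsto_exp_neg_atTop_nhds_zero.comp ?_)
    exact tendsto_natCast_atTop_atTop.const_mul_atTop (by positivity)
  have hφi : ∀ n θ, Integrable (φ n) (dataLaw M ρ θ n) := fun n θ =>
    Integrable.of_bound (hφm n).aestronglyMeasurable 1 (ae_of_all _ fun D => by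
      rw [Real.norm_of_nonneg (hφ01 n D).1]; exact (hφ01 n D).2)
  -- the first kind of error
  have hE1 : ∀ n, dataLaw M ρ θ₀ n {D | 1 / 2 ≤ φ n D} ≤ 2 * (ENNReal.ofReal B * (u n * u n)) := by
    intro n
    have h1 : ∫⁻ D, ENNReal.ofReal (φ n D) ∂(dataLaw M ρ θ₀ n) ≤
        ENNReal.ofReal B * (u n * u n) := by
      rw [← huu, ← ofReal_integral_eq_lintegral_ofReal (hφi n θ₀) (ae_of_all _ fun D => (hφ01 n D).1)]
      exact ENNReal.ofReal_le_ofReal (hφ n).1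
    have h2 := (mul_meas_ge_le_lintegral₀ (μ := dataLaw M ρ θ₀ n)
      (hφm n).ennreal_ofReal.aemeasurable (ENNReal.ofReal (1 / 2))).trans h1
    have h3 : {D | 1 / 2 ≤ φ n D} ⊆ {D | ENNReal.ofReal (1 / 2) ≤ ENNReal.ofReal (φ n D)} :=
      fun D hD => ENNReal.ofReal_le_ofReal hD
    calc _ ≤ dataLaw M ρ θ₀ n {D | ENNReal.ofReal (1 / 2) ≤ ENNReal.ofReal (φ n D)} :=
          measure_mono h3
      _ = 2 * (ENNReal.ofReal (1 / 2) *
          dataLaw M ρ θ₀ n {D | ENNReal.ofReal (1 / 2) ≤ ENNReal.ofReal (φ n D)}) := by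
          rw [← mul_assoc, show (2 : ℝ≥0∞) = ENNReal.ofReal 2 by simp,
            ← ENNReal.ofReal_mul (by norm_num)]
          norm_num
      _ ≤ _ := by gcongr
  -- the second kind of error
  have hE2 : ∀ n, ∫⁻ D, ENNReal.ofReal (1 - φ n D) *
      ∫⁻ θ, likelihoodRatio M θ₀ D θ * F θ ∂prior ∂(dataLaw M ρ θ₀ n) ≤
      ENNReal.ofReal B * (u n * u n) * K := by
    intro n
    have hR := measurable_likelihoodRatio M θ₀ n
    have hψ : Measurable fun D => ENNReal.ofReal (1 - φ n D) :=
      (measurable_const.sub (hφm n)).ennreal_ofReal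
    -- After the exchange the likelihood ratio turns the law under `θ₀` into the law under `θ`,
    -- where the test bound applies for each far `θ`; the weight `F` is carried along.
    have hsw : ∫⁻ D, ENNReal.ofReal (1 - φ n D) *
        ∫⁻ θ, likelihoodRatio M θ₀ D θ * F θ ∂prior ∂(dataLaw M ρ θ₀ n) =
        ∫⁻ θ, F θ * ∫⁻ D, ENNReal.ofReal (1 - φ n D) ∂(dataLaw M ρ θ n) ∂prior := by
      have h1 : ∀ D, ENNReal.ofReal (1 - φ n D) * ∫⁻ θ, likelihoodRatio M θ₀ D θ * F θ ∂prior =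
          ∫⁻ θ, ENNReal.ofReal (1 - φ n D) * (likelihoodRatio M θ₀ D θ * F θ) ∂prior := fun D =>
        (lintegral_const_mul' _ _ ENNReal.ofReal_ne_top).symm
      simp_rw [h1]
      rw [lintegral_lintegral_swap]
      · refine lintegral_congr fun θ => ?_
        rw [lintegral_dataLaw M ρ θ₀ θ n hψ, ← lintegral_const_mul]
        · refine lintegral_congr fun D => ?_
          ring
        · exact (measurable_likelihoodRatio_left M θ₀ θ n).mul hψ
      · exact ((hψ.comp measurable_fst).mul (hR.mul (hFm.comp measurable_snd))).aemeasurable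
    rw [hsw, ← lintegral_const_mul _ hk]
    apply lintegral_mono
    intro θ
    beta_reduce
    by_cases hθ : r < dist θ θ₀
    · have : F θ = k θ := by simp [hF, hθ]
      rw [this, mul_comm, ← huu]
      gcongr
      rw [← ofReal_integral_eq_lintegral_ofReal (f := fun D => 1 - φ n D)
        ((integrable_const _).sub (hφi n θ))
        (ae_of_all _ fun D => sub_nonneg.mpr (hφ01 n D).2)]
      exact ENNReal.ofReal_le_ofReal ((hφ n).2 θ hθ)
    · have : F θ = 0 := by simp [hF, hθ]
      simp [this]
  rw [ENNReal.tendsto_nhds_zero]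
  intro e he
  obtain ⟨e', he'0, he'⟩ : ∃ e' : ℝ, 0 < e' ∧ ENNReal.ofReal e' ≤ e / 2 := by
    by_cases ht : e = ∞
    · exact ⟨1, one_pos, by simp [ht, ENNReal.top_div_of_ne_top]⟩
    · refine ⟨(e / 2).toReal, ENNReal.toReal_pos (by simp [he.ne'])
        (ENNReal.div_ne_top ht (by simp)), ?_⟩
      rw [ENNReal.ofReal_toReal (ENNReal.div_ne_top ht (by simp))]
  obtain ⟨c, hc0, hct, hev⟩ := hKL.eventually_evidence M prior ρ (half_pos hb) he'0
  set q : ℝ≥0∞ := ENNReal.ofReal δ * c * ENNReal.ofReal (1 / 2) with hq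
  have hq0 : q ≠ 0 := by simp [hq, hδ, hc0]
  have hqt : q ≠ ∞ := by
    exact ENNReal.mul_ne_top (ENNReal.mul_ne_top ENNReal.ofReal_ne_top hct) ENNReal.ofReal_ne_top
  -- Markov's inequality at level `q * u n`, the value forced on the numerator when the evidence is
  -- large, the test is below `1 / 2` and the weighted posterior mass is at least `δ`.
  have hE3 : ∀ n, dataLaw M ρ θ₀ n {D | q * u n ≤ ENNReal.ofReal (1 - φ n D) *
      ∫⁻ θ, likelihoodRatio M θ₀ D θ * F θ ∂prior} ≤ ENNReal.ofReal B * K / q * u n := by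
    intro n
    have hm : Measurable fun D => ENNReal.ofReal (1 - φ n D) *
        ∫⁻ θ, likelihoodRatio M θ₀ D θ * F θ ∂prior :=
      (measurable_const.sub (hφm n)).ennreal_ofReal.mul
        ((measurable_likelihoodRatio M θ₀ n).mul
          (hFm.comp measurable_snd)).lintegral_prod_right'
    have h1 := (mul_meas_ge_le_lintegral₀ (μ := dataLaw M ρ θ₀ n) hm.aemeasurable
      (q * u n)).trans (hE2 n)
    refine (ENNReal.mul_le_mul_iff_right (mul_ne_zero hq0 (hu0 n))
      (ENNReal.mul_ne_top hqt (hut n))).mp (h1.trans (le_of_eq ?_))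
    rw [div_eq_mul_inv]
    calc _ = ENNReal.ofReal B * (u n * u n) * K * 1 := by rw [mul_one]
      _ = _ := by rw [← ENNReal.mul_inv_cancel hq0 hqt]; ring
  have hlim : Tendsto (fun n => 2 * (ENNReal.ofReal B * (u n * u n)) +
      ENNReal.ofReal B * K / q * u n) atTop (𝓝 0) := by
    have h1 : Tendsto (fun n => u n * u n) atTop (𝓝 0) := by
      have := ENNReal.Tendsto.mul hulim (Or.inr ENNReal.zero_ne_top) hulim
        (Or.inr ENNReal.zero_ne_top)
      simpa using this
    have h2 : Tendsto (fun n => 2 * (ENNReal.ofReal B * (u n * u n))) atTop (𝓝 0) := by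
      simpa using ENNReal.Tendsto.const_mul (ENNReal.Tendsto.const_mul h1
        (Or.inr ENNReal.ofReal_ne_top)) (Or.inr (ENNReal.ofNat_ne_top (n := 2)))
    have h3 : Tendsto (fun n => ENNReal.ofReal B * K / q * u n) atTop (𝓝 0) := by
      simpa using ENNReal.Tendsto.const_mul hulim (Or.inr (ENNReal.div_ne_top
        (ENNReal.mul_ne_top ENNReal.ofReal_ne_top hki) hq0))
    simpa using h2.add h3
  have he2 : 0 < e / 2 := ENNReal.div_pos he.ne' (by simp)
  filter_upwards [hev, (ENNReal.tendsto_nhds_zero.mp hlim) (e / 2) he2] with n hn1 hn2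
  have hsub : {D | ENNReal.ofReal δ ≤
      ∫⁻ θ in {θ | r < dist θ θ₀}, k θ ∂(bayesPosterior M prior D)} ⊆
      {D | ∫⁻ θ, likelihoodRatio M θ₀ D θ ∂prior < u n * c} ∪
      ({D | 1 / 2 ≤ φ n D} ∪ {D | q * u n ≤ ENNReal.ofReal (1 - φ n D) *
        ∫⁻ θ, likelihoodRatio M θ₀ D θ * F θ ∂prior}) := by
    intro D hD
    by_cases h1 : ∫⁻ θ, likelihoodRatio M θ₀ D θ ∂prior < u n * c
    · exact Or.inl h1
    by_cases h2 : 1 / 2 ≤ φ n D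
    · exact Or.inr (Or.inl h2)
    refine Or.inr (Or.inr ?_)
    simp only [Set.mem_ofPred_eq] at hD ⊢
    rw [← lintegral_indicator hfar, lintegral_bayesPosterior M prior D hFm] at hD
    have hev0 := evidence_ne_zero M prior D
    -- Infinite evidence gives the zero posterior, contradicting a weighted mass of at least `δ >
    -- 0`.
    have hevt : evidence M prior D ≠ ∞ := by
      intro ht
      rw [ht] at hD
      simp [hδ.not_ge] at hD
    have hD2 : ENNReal.ofReal δ * evidence M prior D ≤ ∫⁻ θ, likelihood M D θ * F θ ∂prior := by
      calc _ ≤ (evidence M prior D)⁻¹ * (∫⁻ θ, likelihood M D θ * F θ ∂prior) *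
            evidence M prior D := by gcongr
        _ = _ := by
          rw [mul_comm, ← mul_assoc, ENNReal.mul_inv_cancel hev0 hevt, one_mul]
    have hl := ENNReal.inv_ne_top.mpr (likelihood_ne_zero M D θ₀)
    have hden : ∫⁻ θ, likelihoodRatio M θ₀ D θ ∂prior =
        evidence M prior D * (likelihood M D θ₀)⁻¹ := by
      simp only [likelihoodRatio]
      rw [lintegral_mul_const' _ _ hl]; rfl
    have hnum : ∫⁻ θ, likelihoodRatio M θ₀ D θ * F θ ∂prior =
        (∫⁻ θ, likelihood M D θ * F θ ∂prior) * (likelihood M D θ₀)⁻¹ := by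
      rw [← lintegral_mul_const' _ _ hl]
      refine lintegral_congr fun θ => ?_
      simp only [likelihoodRatio]; ring
    rw [not_lt] at h1
    have h3 : ENNReal.ofReal (1 / 2) ≤ ENNReal.ofReal (1 - φ n D) :=
      ENNReal.ofReal_le_ofReal (by linarith)
    calc q * u n = ENNReal.ofReal (1 / 2) * (ENNReal.ofReal δ * (u n * c)) := by
          rw [hq]; ring
      _ ≤ ENNReal.ofReal (1 - φ n D) *
          (ENNReal.ofReal δ * ∫⁻ θ, likelihoodRatio M θ₀ D θ ∂prior) := by gcongr
      _ ≤ _ := by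
          rw [hden, hnum, ← mul_assoc (ENNReal.ofReal δ)]
          gcongr
  calc _ ≤ _ := measure_mono hsub
    _ ≤ _ := measure_union_le _ _
    _ ≤ ENNReal.ofReal e' + (2 * (ENNReal.ofReal B * (u n * u n)) +
      ENNReal.ofReal B * K / q * u n) := by
        refine add_le_add hn1 ((measure_union_le _ _).trans (add_le_add (hE1 n) (hE3 n)))
    _ ≤ e / 2 + e / 2 := add_le_add he' hn2
    _ = e := ENNReal.add_halves e

end Consistency

/-! ### Pointwise relative entropy -/

section RelativeEntropy

/-- The integrand `a log (a / b) + b - a` of the relative entropy of two densities. -/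
def relEnt (a b : ℝ) : ℝ := a * Real.log (a / b) + b - a

@[fun_prop]
lemma measurable_relEnt {X : Type*} [MeasurableSpace X] {f g : X → ℝ} (hf : Measurable f)
    (hg : Measurable g) : Measurable fun x => relEnt (f x) (g x) :=
  ((hf.mul (hf.div hg).log).add hg).sub hf

/-- Pointwise form of the bound of squared Hellinger distance by relative entropy, from `log x ≤ x -
1` at `x = √b / √a`. It needs no normalisation of `a` or `b`. -/
lemma sq_sqrt_sub_sqrt_le_relEnt {a b : ℝ} (ha : 0 < a) (hb : 0 < b) :
    (√a - √b) ^ 2 ≤ relEnt a b := by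
  have hsa := Real.sqrt_pos.mpr ha
  have hsb := Real.sqrt_pos.mpr hb
  have h1 := Real.log_le_sub_one_of_pos (div_pos hsb hsa)
  have h2 : Real.log (a / b) = -(2 * Real.log (√b / √a)) := by
    rw [Real.log_div ha.ne' hb.ne', Real.log_div hsb.ne' hsa.ne', Real.log_sqrt ha.le,
      Real.log_sqrt hb.le]
    ring
  have h3 : a * (√b / √a) = √a * √b := by
    nth_rw 1 [← Real.mul_self_sqrt ha.le]
    field_simp
  have h4 : (√a - √b) ^ 2 = a - 2 * (√a * √b) + b := by
    have := Real.sq_sqrt ha.le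
    have := Real.sq_sqrt hb.le
    nlinarith
  rw [relEnt, h2, h4]
  nlinarith

lemma relEnt_nonneg {a b : ℝ} (ha : 0 < a) (hb : 0 < b) : 0 ≤ relEnt a b :=
  (sq_nonneg _).trans (sq_sqrt_sub_sqrt_le_relEnt ha hb)

/-- Enlarging the second argument decreases the logarithm, so only the linear term pays. Used near
`θ₀`, with `c` the contamination. -/
lemma relEnt_add_le {a b c : ℝ} (ha : 0 < a) (hb : 0 < b) (hc : 0 ≤ c) :
    relEnt a (b + c) ≤ relEnt a b + c := by
  have : Real.log (a / (b + c)) ≤ Real.log (a / b) :=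
    Real.log_le_log (by positivity) (div_le_div_of_nonneg_left ha.le hb (by linarith))
  have := mul_le_mul_of_nonneg_left this ha.le
  simp only [relEnt]; linarith

/-- The denominator is at least `α * b`, which costs `log α⁻¹` per unit of `a`. Used far from `θ₀`,
where the contamination rather than the true density does the work. -/
lemma relEnt_add_mul_le {a b c α : ℝ} (ha : 0 < a) (hb : 0 < b) (hc : 0 ≤ c) (hα : 0 < α)
    (hα1 : α ≤ 1) : relEnt a (c + α * b) ≤ relEnt a b + c + a * Real.log α⁻¹ := by
  have h1 : Real.log (a / (c + α * b)) ≤ Real.log (a / b * α⁻¹) := by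
    refine Real.log_le_log (by positivity) ?_
    rw [div_mul_eq_mul_div, ← div_eq_mul_inv, div_div]
    exact div_le_div_of_nonneg_left ha.le (by positivity) (by nlinarith)
  rw [Real.log_mul (by positivity) (by positivity)] at h1
  have := mul_le_mul_of_nonneg_left h1 ha.le
  simp only [relEnt]; nlinarith

/-- Changing the second argument changes `relEnt` by an affine function of `a`. Averaging with `b`
the mean of `a` turns this function into `relEnt b c`, which is the compensation identity. -/
lemma relEnt_eq_add {a b c : ℝ} (ha : 0 < a) (hb : 0 < b) (hc : 0 < c) :
    relEnt a c = relEnt a b + (a * Real.log (b / c) + c - b) := by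
  simp only [relEnt]
  rw [Real.log_div ha.ne' hb.ne', Real.log_div ha.ne' hc.ne', Real.log_div hb.ne' hc.ne']
  ring

/-- Compensation inequality: the average relative entropy to `m` is at least the average relative
entropy to the mean plus the relative entropy of the mean to `m`. -/
lemma lintegral_relEnt_mean_add_le {Θ : Type*} [MeasurableSpace Θ] (q : Measure Θ)
    [IsProbabilityMeasure q] {g : Θ → ℝ} (hg : Measurable g) (hg0 : ∀ θ, 0 < g θ)
    (hgi : Integrable g q) (hz : 0 < ∫ θ, g θ ∂q) {m : ℝ} (hm : 0 < m) :
    ∫⁻ θ, ENNReal.ofReal (relEnt (g θ) (∫ θ, g θ ∂q)) ∂q +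
      ENNReal.ofReal (relEnt (∫ θ, g θ ∂q) m) ≤ ∫⁻ θ, ENNReal.ofReal (relEnt (g θ) m) ∂q := by
  set z := ∫ θ, g θ ∂q
  -- An infinite right side makes the claim trivial; otherwise all the terms are integrable and the
  -- identity holds in the reals.
  by_cases htop : ∫⁻ θ, ENNReal.ofReal (relEnt (g θ) m) ∂q = ∞
  · rw [htop]; exact le_top
  have hi : Integrable (fun θ => relEnt (g θ) m) q := by
    refine ⟨(measurable_relEnt hg measurable_const).aestronglyMeasurable, ?_⟩
    rw [hasFiniteIntegral_iff_ofReal (ae_of_all _ fun θ => relEnt_nonneg (hg0 θ) hm)]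
    exact lt_top_iff_ne_top.mpr htop
  have hb : Integrable (fun θ => g θ * Real.log (z / m) + m - z) q :=
    ((hgi.mul_const _).add (integrable_const _)).sub (integrable_const _)
  have he : (fun θ => relEnt (g θ) m) =
      fun θ => relEnt (g θ) z + (g θ * Real.log (z / m) + m - z) :=
    funext fun θ => relEnt_eq_add (hg0 θ) hz hm
  have hiz : Integrable (fun θ => relEnt (g θ) z) q := by
    have := hi.sub hb
    refine this.congr (ae_of_all _ fun θ => ?_)
    simp only [Pi.sub_apply]
    rw [relEnt_eq_add (hg0 θ) hz hm]; ring
  have hbz : ∫ θ, (g θ * Real.log (z / m) + m - z) ∂q = relEnt z m := by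
    simp_rw [add_sub_assoc]
    rw [integral_add (hgi.mul_const _) (integrable_const _), integral_mul_const]
    simp [relEnt, z, add_sub_assoc]
  rw [← ofReal_integral_eq_lintegral_ofReal hi
      (ae_of_all _ fun θ => relEnt_nonneg (hg0 θ) hm),
    ← ofReal_integral_eq_lintegral_ofReal hiz (ae_of_all _ fun θ => relEnt_nonneg (hg0 θ) hz),
    ← ENNReal.ofReal_add (integral_nonneg fun θ => relEnt_nonneg (hg0 θ) hz)
      (relEnt_nonneg hz hm)]
  apply ENNReal.ofReal_le_ofReal
  rw [he, integral_add hiz hb, hbz]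

end RelativeEntropy

/-! ### Mixture densities and mutual information -/

section Mixture

variable {Θ : Type*} [MeasurableSpace Θ]

/-- The mixture density `∫ g θ y q(dθ)`. -/
def mixture (q : Measure Θ) (G : Θ → ℝ → ℝ) (y : ℝ) : ℝ := ∫ θ, G θ y ∂q

variable (q : Measure Θ) [IsProbabilityMeasure q] {G : Θ → ℝ → ℝ}
  (hG : Measurable (Function.uncurry G)) (hG0 : ∀ θ y, 0 < G θ y)
  (hG1 : ∀ θ, ∫⁻ y, ENNReal.ofReal (G θ y) = 1)

include hG

lemma measurable_mixture : Measurable (mixture q G) :=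
  (StronglyMeasurable.integral_prod_right (ν := q) (f := fun y θ => G θ y)
    (hG.comp measurable_swap).stronglyMeasurable).measurable

include hG0 hG1

omit [IsProbabilityMeasure q] in
lemma integrable_mul_density {φ : Θ → ℝ} (hφm : Measurable φ) (hφ : Integrable φ q) :
    Integrable (fun p : Θ × ℝ => φ p.1 * G p.1 p.2) (q.prod volume) := by
  refine ⟨((hφm.comp measurable_fst).mul hG).aestronglyMeasurable, ?_⟩
  have hm : Measurable fun p : Θ × ℝ => ‖φ p.1 * G p.1 p.2‖ₑ :=
    ((hφm.comp measurable_fst).mul hG).enorm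
  rw [HasFiniteIntegral, lintegral_prod _ hm.aemeasurable]
  have : ∀ θ, ∫⁻ y, ‖φ θ * G θ y‖ₑ = ‖φ θ‖ₑ := by
    intro θ
    simp_rw [enorm_mul]
    rw [lintegral_const_mul' _ _ enorm_ne_top]
    have : ∀ y, ‖G θ y‖ₑ = ENNReal.ofReal (G θ y) := fun y =>
      Real.enorm_of_nonneg (hG0 θ y).le
    simp_rw [this, hG1, mul_one]
  simp_rw [this]
  exact hφ.2

lemma integrable_density : Integrable (fun p : Θ × ℝ => G p.1 p.2) (q.prod volume) := by
  simpa using integrable_mul_density q hG hG0 hG1 (φ := fun _ => 1) measurable_const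
    (integrable_const _)

lemma integral_density (θ : Θ) : ∫ y, G θ y = 1 := by
  rw [integral_eq_lintegral_of_nonneg_ae (ae_of_all _ fun y => (hG0 θ y).le)
    (hG.comp measurable_prodMk_left).aestronglyMeasurable, hG1]
  simp

lemma ae_integrable_density : ∀ᵐ y, Integrable (fun θ => G θ y) q :=
  (integrable_density q hG hG0 hG1).prod_left_ae

lemma ae_mixture_pos : ∀ᵐ y, 0 < mixture q G y := by
  filter_upwards [ae_integrable_density q hG hG0 hG1] with y hy
  rw [mixture, integral_pos_iff_support_of_nonneg (fun θ => (hG0 θ y).le) hy]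
  have : Function.support (fun θ => G θ y) = Set.univ := by
    ext θ; simp [(hG0 θ y).ne']
  simp [this]

lemma integrable_mixture : Integrable (mixture q G) :=
  (integrable_density q hG hG0 hG1).integral_prod_right

lemma integral_mixture : ∫ y, mixture q G y = 1 := by
  simp only [mixture]
  rw [integral_integral_swap]
  · simp [integral_density hG hG0 hG1]
  · exact (integrable_density q hG hG0 hG1).swap

lemma ae_ofReal_mixture :
    ∀ᵐ y, ENNReal.ofReal (mixture q G y) = ∫⁻ θ, ENNReal.ofReal (G θ y) ∂q := by
  filter_upwards [ae_integrable_density q hG hG0 hG1] with y hy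
  exact ofReal_integral_eq_lintegral_ofReal hy (ae_of_all _ fun θ => (hG0 θ y).le)

lemma lintegral_mixture : ∫⁻ y, ENNReal.ofReal (mixture q G y) = 1 := by
  rw [← ofReal_integral_eq_lintegral_ofReal (integrable_mixture q hG hG0 hG1)
    ((ae_mixture_pos q hG hG0 hG1).mono fun y hy => hy.le), integral_mixture q hG hG0 hG1]
  simp

/-- The mutual information of the parameter and the observation. -/
def mutualInfo (q : Measure Θ) (G : Θ → ℝ → ℝ) : ℝ≥0∞ :=
  ∫⁻ y, ∫⁻ θ, ENNReal.ofReal (relEnt (G θ y) (mixture q G y)) ∂q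

/-- The compensation inequality for almost every `y`, integrated in `y`. Since `m` need not have
mass one, the contaminated density can be used without renormalising; dropping either summand on the
left bounds the other. -/
lemma mutualInfo_add_le {m : ℝ → ℝ} (hm : Measurable m) (hm0 : ∀ᵐ y, 0 < m y) :
    mutualInfo q G + ∫⁻ y, ENNReal.ofReal (relEnt (mixture q G y) (m y)) ≤
      ∫⁻ θ, ∫⁻ y, ENNReal.ofReal (relEnt (G θ y) (m y)) ∂volume ∂q := by
  have hmix := measurable_mixture q hG
  rw [lintegral_lintegral_swap (f := fun θ y => ENNReal.ofReal (relEnt (G θ y) (m y)))]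
  · rw [mutualInfo, ← lintegral_add_right _
      (measurable_relEnt hmix hm).ennreal_ofReal]
    refine lintegral_mono_ae ?_
    filter_upwards [hm0, ae_integrable_density q hG hG0 hG1, ae_mixture_pos q hG hG0 hG1]
      with y h1 h2 h3
    exact lintegral_relEnt_mean_add_le q (hG.comp measurable_prodMk_right)
      (fun θ => hG0 θ y) h2 h3 h1
  · exact (measurable_relEnt hG (hm.comp measurable_snd)).ennreal_ofReal.aemeasurable

/-- The expected entropy decrease, under the predictive law, is the mutual information. -/
lemma enorm_integral_mixture_mul {φ : Θ → ℝ} (hφm : Measurable φ) (hφ : Integrable φ q)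
    {h : ℝ → ℝ} (hh : Integrable (fun y => mixture q G y * h y))
    (hint : ∀ᵐ y, Integrable (fun θ => (φ θ + Real.log (G θ y / mixture q G y)) *
      (G θ y / mixture q G y)) q)
    (heq : ∀ᵐ y, h y = -(∫ θ, φ θ ∂q) + ∫ θ, (φ θ + Real.log (G θ y / mixture q G y)) *
      (G θ y / mixture q G y) ∂q) :
    ‖∫ y, mixture q G y * h y‖ₑ = mutualInfo q G := by
  have hφG := integrable_mul_density q hG hG0 hG1 hφm hφ
  set K : ℝ → ℝ := fun y => ∫ θ, relEnt (G θ y) (mixture q G y) ∂q with hK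
  have hK0 : ∀ᵐ y, 0 ≤ K y := by
    filter_upwards [ae_mixture_pos q hG hG0 hG1] with y hy
    exact integral_nonneg fun θ => relEnt_nonneg (hG0 θ y) hy
  have key : ∀ᵐ y, Integrable (fun θ => relEnt (G θ y) (mixture q G y)) q ∧
      mixture q G y * h y = -(∫ θ, φ θ ∂q) * mixture q G y + (∫ θ, φ θ * G θ y ∂q) + K y := by
    filter_upwards [ae_integrable_density q hG hG0 hG1, ae_mixture_pos q hG hG0 hG1, hint, heq,
      hφG.prod_left_ae] with y h1 h2 h3 h4 h5
    -- The logarithmic term is `relEnt` up to `G θ y - mixture q G y`, which has `q`-mean zero.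
    have e1 : ∀ θ, mixture q G y * ((φ θ + Real.log (G θ y / mixture q G y)) *
        (G θ y / mixture q G y)) = φ θ * G θ y +
          (relEnt (G θ y) (mixture q G y) + (G θ y - mixture q G y)) := by
      intro θ
      simp only [relEnt]
      field_simp
      ring
    have h6 : Integrable (fun θ => G θ y - mixture q G y) q := h1.sub (integrable_const _)
    have h7 : Integrable (fun θ => relEnt (G θ y) (mixture q G y)) q := by
      refine (((h3.const_mul (mixture q G y)).sub h5).sub h6).congr (ae_of_all _ fun θ => ?_)
      simp only [Pi.sub_apply]
      rw [e1]; ring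
    refine ⟨h7, ?_⟩
    have h8 : ∫ θ, (G θ y - mixture q G y) ∂q = 0 := by
      rw [integral_sub h1 (integrable_const _)]; simp [mixture]
    have h9 : Integrable (fun θ => relEnt (G θ y) (mixture q G y) +
        (G θ y - mixture q G y)) q := h7.add h6
    rw [h4, mul_add, ← integral_const_mul]
    simp_rw [e1]
    rw [integral_add h5 h9, integral_add h7 h6, h8]
    simp only [hK]; ring
  have he : Integrable (fun y => ∫ θ, φ θ * G θ y ∂q) := hφG.integral_prod_right
  have hmix := integrable_mixture q hG hG0 hG1
  -- Integrability of the mutual information integrand is deduced from that of `mixture q G y * h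
  -- y`, so finiteness comes out of the argument.
  have hKi : Integrable K := by
    refine ((hh.sub (hmix.const_mul (-(∫ θ, φ θ ∂q)))).sub he).congr ?_
    filter_upwards [key] with y hy
    simp only [Pi.sub_apply]
    rw [hy.2]; ring
  -- Each density has mass one, so this term cancels the entropy term `-(∫ θ, φ θ ∂q)` and only the
  -- relative entropy survives.
  have hev : ∫ y, ∫ θ, φ θ * G θ y ∂q = ∫ θ, φ θ ∂q := by
    rw [integral_integral_swap (f := fun y θ => φ θ * G θ y) hφG.swap]
    refine integral_congr_ae (ae_of_all _ fun θ => ?_)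
    simp only
    rw [integral_const_mul, integral_density hG hG0 hG1, mul_one]
  have hval : ∫ y, mixture q G y * h y = ∫ y, K y := by
    rw [integral_congr_ae (key.mono fun y hy => hy.2)]
    rw [integral_add (f := fun y => -(∫ θ, φ θ ∂q) * mixture q G y + ∫ θ, φ θ * G θ y ∂q)
      ((hmix.const_mul _).add he) hKi, integral_add (hmix.const_mul _) he, integral_const_mul,
      integral_mixture q hG hG0 hG1, hev]
    ring
  rw [hval, Real.enorm_of_nonneg (integral_nonneg_of_ae hK0),
    ofReal_integral_eq_lintegral_ofReal hKi hK0, mutualInfo]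
  refine lintegral_congr_ae ?_
  filter_upwards [key, ae_mixture_pos q hG hG0 hG1] with y hy h2
  exact ofReal_integral_eq_lintegral_ofReal hy.1 (ae_of_all _ fun θ => relEnt_nonneg (hG0 θ y) h2)

end Mixture

/-! ### From the predictive law to the true law -/

section Comparison

variable {Θ : Type*} [MeasurableSpace Θ]

/-- Factor `|a - b| = |√a - √b| (√a + √b)` and apply the weighted arithmetic-geometric inequality
with parameter `τ`. The Hellinger term passes through `√m`: one leg is bounded by `relEnt b m`, the
other by `m - a` since `a ≤ m`. -/
lemma abs_mul_abs_sub_le {a b m h τ : ℝ} (ha : 0 < a) (hb : 0 < b) (hm : a ≤ m) (hτ : 0 < τ) :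
    |h| * |a - b| ≤ 2 * τ * (h ^ 2 * (a + b)) + τ⁻¹ * (2 * relEnt b m + 2 * (m - a)) := by
  have hm0 : 0 < m := ha.trans_le hm
  have h1 := sq_sqrt_sub_sqrt_le_relEnt hb hm0
  have sa := Real.sq_sqrt ha.le
  have sb := Real.sq_sqrt hb.le
  have sm := Real.sq_sqrt hm0.le
  have pa := Real.sqrt_nonneg a
  have pb := Real.sqrt_nonneg b
  have hle := Real.sqrt_le_sqrt hm
  set x := √a
  set y := √b
  set z := √m
  have h2 : (x - y) ^ 2 ≤ 2 * relEnt b m + 2 * (m - a) := by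
    have : (z - x) ^ 2 ≤ m - a := by nlinarith
    nlinarith [sq_nonneg ((y - z) - (z - x))]
  have h3 : |a - b| = |x - y| * (x + y) := by
    rw [← abs_of_nonneg (add_nonneg pa pb), ← abs_mul]
    congr 1; rw [← sa, ← sb]; ring
  have h4 : (x + y) ^ 2 ≤ 2 * (a + b) := by nlinarith [sq_nonneg (x - y)]
  have h5 : |h| * |a - b| ≤ τ * (|h| * (x + y)) ^ 2 + τ⁻¹ * |x - y| ^ 2 := by
    rw [h3]
    have h6 : 0 ≤ τ⁻¹ * (τ * (|h| * (x + y)) - |x - y|) ^ 2 := by positivity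
    have h7 : τ⁻¹ * (τ * (|h| * (x + y)) - |x - y|) ^ 2 =
        τ * (|h| * (x + y)) ^ 2 + τ⁻¹ * |x - y| ^ 2 - 2 * (|h| * (|x - y| * (x + y))) := by
      field_simp
      ring
    have h8 : 0 ≤ |h| * (|x - y| * (x + y)) := by positivity
    linarith
  rw [mul_pow, sq_abs, sq_abs] at h5
  refine h5.trans (add_le_add ?_ ?_)
  · calc τ * (h ^ 2 * (x + y) ^ 2) ≤ τ * (h ^ 2 * (2 * (a + b))) := by gcongr
      _ = _ := by ring
  · gcongr

lemma abs_mul_le {g h τ : ℝ} (hg : 0 ≤ g) (hτ : 0 < τ) : |h| * g ≤ τ * (h ^ 2 * g) + τ⁻¹ * g := by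
  have h7 : τ⁻¹ * (τ * |h| - 1) ^ 2 = τ * |h| ^ 2 + τ⁻¹ - 2 * |h| := by
    field_simp
    ring
  have h6 : 0 ≤ τ⁻¹ * (τ * |h| - 1) ^ 2 := by positivity
  rw [h7, sq_abs] at h6
  nlinarith [abs_nonneg h]

/-- The integral of a function with respect to a density, in terms of its second moment. -/
lemma lintegral_enorm_mul_density_le {g h : ℝ → ℝ} (hg : Measurable g) (hg0 : ∀ y, 0 ≤ g y)
    (hg1 : ∫⁻ y, ENNReal.ofReal (g y) = 1) {τ : ℝ} (hτ : 0 < τ) :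
    ∫⁻ y, ‖g y * h y‖ₑ ≤
      ENNReal.ofReal τ * (∫⁻ y, ‖h y‖ₑ ^ 2 * ENNReal.ofReal (g y)) + ENNReal.ofReal τ⁻¹ := by
  calc ∫⁻ y, ‖g y * h y‖ₑ ≤ ∫⁻ y, (ENNReal.ofReal τ * (‖h y‖ₑ ^ 2 * ENNReal.ofReal (g y)) +
        ENNReal.ofReal τ⁻¹ * ENNReal.ofReal (g y)) := by
        refine lintegral_mono fun y => ?_
        have := abs_mul_le (h := h y) (hg0 y) hτ
        rw [Real.enorm_eq_ofReal_abs, Real.enorm_eq_ofReal_abs, ← ENNReal.ofReal_pow (abs_nonneg _),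
          ← ENNReal.ofReal_mul (by positivity), ← ENNReal.ofReal_mul hτ.le,
          ← ENNReal.ofReal_mul (by positivity),
          ← ENNReal.ofReal_add (mul_nonneg hτ.le (mul_nonneg (by positivity) (hg0 y)))
            (mul_nonneg (by positivity) (hg0 y))]
        apply ENNReal.ofReal_le_ofReal
        rw [abs_mul, abs_of_nonneg (hg0 y), sq_abs, mul_comm]
        exact this
    _ = _ := by
        rw [lintegral_add_right _ (hg.ennreal_ofReal.const_mul _),
          lintegral_const_mul' _ _ ENNReal.ofReal_ne_top,
          lintegral_const_mul' _ _ ENNReal.ofReal_ne_top, hg1, mul_one]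

variable (q : Measure Θ) [IsProbabilityMeasure q] {G : Θ → ℝ → ℝ}
  (hG : Measurable (Function.uncurry G)) (hG0 : ∀ θ y, 0 < G θ y)
  (hG1 : ∀ θ, ∫⁻ y, ENNReal.ofReal (G θ y) = 1)

include hG hG0 hG1

/-- The average relative entropy to a contaminated density is small as soon as `q` is concentrated
on parameters at small relative entropy from `θ₀`. -/
lemma lintegral_relEnt_contaminated_le (prior : Measure Θ) [IsProbabilityMeasure prior] (θ₀ : Θ)
    {α : ℝ} (hα : 0 < α) (hα1 : α ≤ 1) {F : Set Θ} (hF : MeasurableSet F) {κ : ℝ≥0∞}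
    (hκ : ∀ θ ∉ F, ∫⁻ y, ENNReal.ofReal (relEnt (G θ y) (G θ₀ y)) ≤ κ) :
    ∫⁻ θ, ∫⁻ y, ENNReal.ofReal (relEnt (G θ y) (G θ₀ y + α * mixture prior G y)) ∂volume ∂q ≤
      κ + ENNReal.ofReal α + ∫⁻ θ in F, ((∫⁻ y, ENNReal.ofReal
        (relEnt (G θ y) (mixture prior G y))) + 1 + ENNReal.ofReal (Real.log α⁻¹)) ∂q := by
  have hmm := measurable_mixture prior hG
  have hmp := ae_mixture_pos prior hG hG0 hG1
  have hGm : ∀ θ, Measurable (G θ) := fun θ => hG.comp measurable_prodMk_left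
  have hlog : 0 ≤ Real.log α⁻¹ := Real.log_nonneg ((one_le_inv₀ hα).mpr hα1)
  -- Off `F` the contamination adds at most its mass `α`, the mixture density having mass one.
  have hnear : ∀ θ ∉ F, ∫⁻ y, ENNReal.ofReal
      (relEnt (G θ y) (G θ₀ y + α * mixture prior G y)) ≤ κ + ENNReal.ofReal α := by
    intro θ hθ
    calc _ ≤ ∫⁻ y, (ENNReal.ofReal (relEnt (G θ y) (G θ₀ y)) +
          ENNReal.ofReal α * ENNReal.ofReal (mixture prior G y)) := by
          refine lintegral_mono_ae ?_
          filter_upwards [hmp] with y hy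
          rw [← ENNReal.ofReal_mul hα.le,
            ← ENNReal.ofReal_add (relEnt_nonneg (hG0 _ _) (hG0 _ _)) (by positivity)]
          exact ENNReal.ofReal_le_ofReal (relEnt_add_le (hG0 _ _) (hG0 _ _) (by positivity))
      _ = (∫⁻ y, ENNReal.ofReal (relEnt (G θ y) (G θ₀ y))) + ENNReal.ofReal α := by
          rw [lintegral_add_right _ (hmm.ennreal_ofReal.const_mul _),
            lintegral_const_mul' _ _ ENNReal.ofReal_ne_top, lintegral_mixture prior hG hG0 hG1,
            mul_one]
      _ ≤ _ := by gcongr; exact hκ θ hθ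
  -- This bound holds for every `θ` but is used only on `F`. The `1` is the mass of `G θ₀`; the
  -- logarithm is multiplied by the mass of `G θ`.
  have hfar : ∀ θ, ∫⁻ y, ENNReal.ofReal
      (relEnt (G θ y) (G θ₀ y + α * mixture prior G y)) ≤
      (∫⁻ y, ENNReal.ofReal (relEnt (G θ y) (mixture prior G y))) + 1 +
        ENNReal.ofReal (Real.log α⁻¹) := by
    intro θ
    calc _ ≤ ∫⁻ y, (ENNReal.ofReal (relEnt (G θ y) (mixture prior G y)) +
          ENNReal.ofReal (G θ₀ y) + ENNReal.ofReal (G θ y) * ENNReal.ofReal (Real.log α⁻¹)) := by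
          refine lintegral_mono_ae ?_
          filter_upwards [hmp] with y hy
          have h1 := relEnt_nonneg (hG0 θ y) hy
          rw [← ENNReal.ofReal_mul (hG0 _ _).le, ← ENNReal.ofReal_add h1 (hG0 _ _).le,
            ← ENNReal.ofReal_add (add_nonneg h1 (hG0 _ _).le) (mul_nonneg (hG0 _ _).le hlog)]
          exact ENNReal.ofReal_le_ofReal
            (relEnt_add_mul_le (hG0 _ _) hy (hG0 _ _).le hα hα1)
      _ = _ := by
          rw [lintegral_add_right _ ((hGm θ).ennreal_ofReal.mul_const _),
            lintegral_add_right _ (hGm θ₀).ennreal_ofReal,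
            lintegral_mul_const' _ _ ENNReal.ofReal_ne_top, hG1, hG1, one_mul]
  rw [← lintegral_add_compl _ hF, add_comm]
  refine add_le_add ?_ (lintegral_mono fun θ => hfar θ)
  calc _ ≤ ∫⁻ θ in Fᶜ, (κ + ENNReal.ofReal α) ∂q :=
        setLIntegral_mono' hF.compl fun θ hθ => hnear θ hθ
    _ ≤ ∫⁻ θ, (κ + ENNReal.ofReal α) ∂q := setLIntegral_le_lintegral _ _
    _ = _ := by simp

/-- The integral against the true density is controlled by the mutual information, the second
moments and the relative entropies to a contaminated density. -/
lemma enorm_integral_density_mul_le {h m : ℝ → ℝ} (hh : Measurable h) (θ₀ : Θ)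
    (hm : Measurable m) (hmθ : ∀ᵐ y, G θ₀ y ≤ m y)
    (hI : Integrable (fun y => mixture q G y * h y) →
      ‖∫ y, mixture q G y * h y‖ₑ = mutualInfo q G)
    {τ : ℝ} (hτ : 0 < τ) {B : ℝ≥0∞}
    (hB : ∫⁻ θ, ∫⁻ y, ENNReal.ofReal (relEnt (G θ y) (m y)) ∂volume ∂q ≤ B) :
    ‖∫ y, G θ₀ y * h y‖ₑ ≤ B +
      ENNReal.ofReal (2 * τ) * ((∫⁻ y, ‖h y‖ₑ ^ 2 * ENNReal.ofReal (G θ₀ y)) +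
        ∫⁻ y, ‖h y‖ₑ ^ 2 * ENNReal.ofReal (mixture q G y)) +
      ENNReal.ofReal τ⁻¹ * (2 * B + 2 * ∫⁻ y, ENNReal.ofReal (m y - G θ₀ y)) := by
  set S := (∫⁻ y, ‖h y‖ₑ ^ 2 * ENNReal.ofReal (G θ₀ y)) +
    ∫⁻ y, ‖h y‖ₑ ^ 2 * ENNReal.ofReal (mixture q G y) with hS
  have hGm : ∀ θ, Measurable (G θ) := fun θ => hG.comp measurable_prodMk_left
  have hmix := measurable_mixture q hG
  have hpos := ae_mixture_pos q hG hG0 hG1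
  by_cases hStop : S = ∞
  · rw [hStop, ENNReal.mul_top (by simpa using hτ)]
    simp
  have hS1 : ∫⁻ y, ‖h y‖ₑ ^ 2 * ENNReal.ofReal (G θ₀ y) ≠ ∞ :=
    fun htop => hStop (by rw [hS, htop]; simp)
  have hS2 : ∫⁻ y, ‖h y‖ₑ ^ 2 * ENNReal.ofReal (mixture q G y) ≠ ∞ :=
    fun htop => hStop (by rw [hS, htop]; simp)
  have hint1 : Integrable (fun y => G θ₀ y * h y) := by
    refine ⟨((hGm θ₀).mul hh).aestronglyMeasurable, ?_⟩
    refine (lintegral_enorm_mul_density_le (hGm θ₀) (fun y => (hG0 θ₀ y).le) (hG1 θ₀)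
      one_pos).trans_lt ?_
    simpa using hS1.lt_top
  have hint2 : Integrable (fun y => mixture q G y * h y) := by
    refine ⟨(hmix.mul hh).aestronglyMeasurable, ?_⟩
    refine (lintegral_enorm_mul_density_le hmix
      (fun y => integral_nonneg fun θ => (hG0 θ y).le) (lintegral_mixture q hG hG0 hG1)
      one_pos).trans_lt ?_
    simpa using hS2.lt_top
  -- The single bound `B` pays both for the mutual information and for the divergence from the
  -- mixture to `m`.
  have hpyth := mutualInfo_add_le q hG hG0 hG1 hm
    (hmθ.mono fun y hy => (hG0 θ₀ y).trans_le hy)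
  have hIB : mutualInfo q G ≤ B := (le_self_add.trans hpyth).trans hB
  have hZB : ∫⁻ y, ENNReal.ofReal (relEnt (mixture q G y) (m y)) ≤ B :=
    (le_add_self.trans hpyth).trans hB
  have hsplit : ∫ y, G θ₀ y * h y =
      (∫ y, mixture q G y * h y) + ∫ y, (G θ₀ y * h y - mixture q G y * h y) := by
    rw [integral_sub hint1 hint2]; ring
  rw [hsplit, add_assoc]
  refine (enorm_add_le _ _).trans (add_le_add ((hI hint2).trans_le hIB) ?_)
  refine (enorm_integral_le_lintegral_enorm _).trans ?_
  calc ∫⁻ y, ‖G θ₀ y * h y - mixture q G y * h y‖ₑ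
      ≤ ∫⁻ y, (ENNReal.ofReal (2 * τ) * (‖h y‖ₑ ^ 2 * ENNReal.ofReal (G θ₀ y) +
          ‖h y‖ₑ ^ 2 * ENNReal.ofReal (mixture q G y)) + ENNReal.ofReal τ⁻¹ *
          (2 * ENNReal.ofReal (relEnt (mixture q G y) (m y)) +
            2 * ENNReal.ofReal (m y - G θ₀ y))) := by
        refine lintegral_mono_ae ?_
        filter_upwards [hmθ, hpos] with y h1 h2
        have hg := hG0 θ₀ y
        have h3 := abs_mul_abs_sub_le (h := h y) hg h2 h1 hτ
        have h4 := relEnt_nonneg h2 (hg.trans_le h1)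
        have h5 : 0 ≤ m y - G θ₀ y := sub_nonneg.mpr h1
        rw [← mul_add (‖h y‖ₑ ^ 2), ← ENNReal.ofReal_add hg.le h2.le,
          show (2 : ℝ≥0∞) = ENNReal.ofReal 2 by simp, ← ENNReal.ofReal_mul zero_le_two,
          ← ENNReal.ofReal_mul zero_le_two, ← ENNReal.ofReal_add (by positivity) (by positivity),
          Real.enorm_eq_ofReal_abs, Real.enorm_eq_ofReal_abs, ← ENNReal.ofReal_pow (abs_nonneg _),
          ← ENNReal.ofReal_mul (by positivity), ← ENNReal.ofReal_mul (by positivity),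
          ← ENNReal.ofReal_mul (by positivity),
          ← ENNReal.ofReal_add (by positivity) (by positivity)]
        apply ENNReal.ofReal_le_ofReal
        rw [← sub_mul, abs_mul, sq_abs, mul_comm]
        exact h3
    _ = ENNReal.ofReal (2 * τ) * S + ENNReal.ofReal τ⁻¹ *
          (2 * (∫⁻ y, ENNReal.ofReal (relEnt (mixture q G y) (m y))) +
            2 * ∫⁻ y, ENNReal.ofReal (m y - G θ₀ y)) := by
        have m1 : Measurable fun y => ENNReal.ofReal (m y - G θ₀ y) :=
          (hm.sub (hGm θ₀)).ennreal_ofReal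
        have m2 : Measurable fun y => ENNReal.ofReal (relEnt (mixture q G y) (m y)) :=
          (measurable_relEnt hmix hm).ennreal_ofReal
        have m3 : Measurable fun y => ENNReal.ofReal τ⁻¹ *
            (2 * ENNReal.ofReal (relEnt (mixture q G y) (m y)) +
              2 * ENNReal.ofReal (m y - G θ₀ y)) :=
          ((m2.const_mul 2).add (m1.const_mul 2)).const_mul _
        have m4 : Measurable fun y => ‖h y‖ₑ ^ 2 * ENNReal.ofReal (mixture q G y) :=
          (hh.enorm.pow_const 2).mul hmix.ennreal_ofReal
        rw [lintegral_add_right _ m3,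
          lintegral_const_mul' _ _ ENNReal.ofReal_ne_top,
          lintegral_const_mul' _ _ ENNReal.ofReal_ne_top,
          lintegral_add_right _ (m1.const_mul _),
          lintegral_const_mul _ m1, lintegral_const_mul _ m2,
          lintegral_add_right _ m4]
    _ ≤ _ := by gcongr

end Comparison

/-! ### Relative entropy between Gaussians -/

section Gaussian

lemma relEnt_gaussianPDFReal (m m₀ : ℝ) {v v₀ : ℝ≥0} (hv : v ≠ 0) (hv₀ : v₀ ≠ 0) (y : ℝ) :
    relEnt (gaussianPDFReal m v y) (gaussianPDFReal m₀ v₀ y) =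
      gaussianPDFReal m v y * (Real.log (v₀ / v) / 2 - (y - m) ^ 2 / (2 * v) +
        (y - m₀) ^ 2 / (2 * v₀)) + (gaussianPDFReal m₀ v₀ y - gaussianPDFReal m v y) := by
  have hv' : (0 : ℝ) < v := by positivity
  have hv₀' : (0 : ℝ) < v₀ := by positivity
  have hl : ∀ (μ : ℝ) (w : ℝ≥0), (0 : ℝ) < w → Real.log (gaussianPDFReal μ w y) =
      -(Real.log (2 * Real.pi) + Real.log w) / 2 + -(y - μ) ^ 2 / (2 * w) := by
    intro μ w hw
    rw [gaussianPDFReal, Real.log_mul (by positivity) (by positivity), Real.log_exp,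
      Real.log_inv, Real.log_sqrt (by positivity),
      Real.log_mul (by positivity) (by positivity)]
    ring
  rw [relEnt, Real.log_div (gaussianPDFReal_pos m v y hv).ne'
    (gaussianPDFReal_pos m₀ v₀ y hv₀).ne', hl m v hv', hl m₀ v₀ hv₀',
    Real.log_div hv₀'.ne' hv'.ne']
  ring

lemma integrable_sq_sub_gaussianReal (m c : ℝ) (v : ℝ≥0) :
    Integrable (fun y => (y - c) ^ 2) (gaussianReal m v) :=
  ((memLp_id_gaussianReal 2).sub (memLp_const c)).integrable_sq

lemma integral_sq_sub_gaussianReal (m c : ℝ) (v : ℝ≥0) :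
    ∫ y, (y - c) ^ 2 ∂(gaussianReal m v) = v + (m - c) ^ 2 := by
  have hvar : ∫ y, (y - m) ^ 2 ∂(gaussianReal m v) = v := by
    have := variance_eq_integral (μ := gaussianReal m v) (X := fun x => x) aemeasurable_id
    rw [variance_fun_id_gaussianReal, integral_id_gaussianReal] at this
    exact this.symm
  have hid : Integrable (fun y : ℝ => y) (gaussianReal m v) :=
    (memLp_id_gaussianReal 1).integrable le_rfl
  have h0 : Integrable (fun y : ℝ => y - m) (gaussianReal m v) := hid.sub (integrable_const _)
  have h1 : Integrable (fun y : ℝ => 2 * (m - c) * (y - m) + (m - c) ^ 2) (gaussianReal m v) :=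
    (h0.const_mul _).add (integrable_const _)
  have h2 : ∫ y, (y - c) ^ 2 ∂(gaussianReal m v) =
      ∫ y, ((y - m) ^ 2 + (2 * (m - c) * (y - m) + (m - c) ^ 2)) ∂(gaussianReal m v) := by
    congr 1; ext y; ring
  rw [h2, integral_add (integrable_sq_sub_gaussianReal m m v) h1, hvar,
    integral_add (h0.const_mul _) (integrable_const _),
    integral_const_mul, integral_sub hid (integrable_const _), integral_id_gaussianReal]
  simp

/-- The logarithm of the density quotient is quadratic, so Gaussian second moments give a closed
form; the two linear terms of `relEnt` cancel because both densities have mass one. The formula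
makes continuity in mean and variance evident. -/
lemma lintegral_relEnt_gaussianPDFReal (m m₀ : ℝ) {v v₀ : ℝ≥0} (hv : v ≠ 0) (hv₀ : v₀ ≠ 0) :
    ∫⁻ y, ENNReal.ofReal (relEnt (gaussianPDFReal m v y) (gaussianPDFReal m₀ v₀ y)) =
      ENNReal.ofReal (Real.log (v₀ / v) / 2 - v / (2 * v) + (v + (m - m₀) ^ 2) / (2 * v₀)) := by
  set P : ℝ → ℝ := fun y => Real.log (v₀ / v) / 2 - (y - m) ^ 2 / (2 * v) +
    (y - m₀) ^ 2 / (2 * v₀) with hP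
  have hi1 : Integrable (fun y => Real.log (v₀ / v) / 2 - (y - m) ^ 2 / (2 * v))
      (gaussianReal m v) :=
    (integrable_const _).sub ((integrable_sq_sub_gaussianReal m m v).div_const _)
  have hi2 := (integrable_sq_sub_gaussianReal m m₀ v).div_const (2 * v₀)
  have hPi : Integrable P (gaussianReal m v) := hi1.add hi2
  have hPint : ∫ y, P y ∂(gaussianReal m v) =
      Real.log (v₀ / v) / 2 - v / (2 * v) + (v + (m - m₀) ^ 2) / (2 * v₀) := by
    rw [hP, integral_add hi1 hi2, integral_sub (integrable_const _)
      ((integrable_sq_sub_gaussianReal m m v).div_const _), integral_div, integral_div, integral_div,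
      integral_sq_sub_gaussianReal, integral_sq_sub_gaussianReal]
    simp
  have hPv : Integrable (fun y => gaussianPDFReal m v y * P y) := by
    rw [gaussianReal_of_var_ne_zero _ hv, integrable_withDensity_iff_integrable_smul'
      (measurable_gaussianPDF _ _) (ae_of_all _ fun _ => gaussianPDF_lt_top)] at hPi
    simpa using hPi
  have hd := (integrable_gaussianPDFReal m₀ v₀).sub (integrable_gaussianPDFReal m v)
  have he := relEnt_gaussianPDFReal m m₀ hv hv₀
  rw [← ofReal_integral_eq_lintegral_ofReal]
  · have : ∫ y, (gaussianPDFReal m v y * P y +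
        (gaussianPDFReal m₀ v₀ - gaussianPDFReal m v) y) = ∫ y, P y ∂(gaussianReal m v) := by
      rw [integral_add hPv hd, integral_sub' (integrable_gaussianPDFReal m₀ v₀)
        (integrable_gaussianPDFReal m v), integral_gaussianPDFReal_eq_one _ hv,
        integral_gaussianPDFReal_eq_one _ hv₀, sub_self, add_zero,
        integral_gaussianReal_eq_integral_smul hv]
      rfl
    rw [← hPint, ← this]
    simp_rw [he]
    rfl
  · simp_rw [he]
    exact hPv.add hd
  · exact ae_of_all _ fun y => relEnt_nonneg (gaussianPDFReal_pos m v y hv)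
      (gaussianPDFReal_pos m₀ v₀ y hv₀)

lemma tendsto_lintegral_relEnt_gaussianPDFReal {ι : Type*} {l : Filter ι} {m : ι → ℝ}
    {v : ι → ℝ≥0} {m₀ : ℝ} {v₀ : ℝ≥0} (hm : Tendsto m l (𝓝 m₀)) (hv : Tendsto v l (𝓝 v₀))
    (hv0 : ∀ i, v i ≠ 0) (hv₀ : v₀ ≠ 0) :
    Tendsto (fun i => ∫⁻ y, ENNReal.ofReal
      (relEnt (gaussianPDFReal (m i) (v i) y) (gaussianPDFReal m₀ v₀ y))) l (𝓝 0) := by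
  have hw₀ : (v₀ : ℝ) ≠ 0 := by exact_mod_cast hv₀
  have hw : Tendsto (fun i => (v i : ℝ)) l (𝓝 v₀) := (NNReal.tendsto_coe).mpr hv
  have h1 : Tendsto (fun i => Real.log (v₀ / v i) / 2 - v i / (2 * v i) +
      (v i + (m i - m₀) ^ 2) / (2 * v₀)) l (𝓝 (Real.log (v₀ / v₀) / 2 - v₀ / (2 * v₀) +
      (v₀ + (m₀ - m₀) ^ 2) / (2 * v₀))) := by
    refine Tendsto.add (Tendsto.sub ?_ ?_) ?_
    · exact ((tendsto_const_nhds.div hw hw₀).log (by simp [hw₀])).div_const _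
    · exact hw.div (hw.const_mul 2) (by simpa using hw₀)
    · exact (hw.add ((hm.sub_const _).pow 2)).div_const _
  have h2 : Real.log (v₀ / v₀) / 2 - v₀ / (2 * v₀) + (v₀ + (m₀ - m₀) ^ 2) / (2 * v₀) = 0 := by
    rw [div_self hw₀]; simp
  rw [h2] at h1
  have := ENNReal.tendsto_ofReal h1
  rw [ENNReal.ofReal_zero] at this
  refine this.congr fun i => (lintegral_relEnt_gaussianPDFReal _ _ (hv0 i) hv₀).symm

end Gaussian

/-! ### Entropy, Bayes updates and the information gain -/

section InformationGain

variable {A Θ : Type*} [MeasurableSpace A] [MeasurableSpace Θ] (M : GaussianDynamics A Θ)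
  (prior lam : Measure Θ) [IsProbabilityMeasure prior] [SigmaFinite lam]

lemma inv_evidence_mul_likelihood_ne_top {n : ℕ} (D : Fin n → Transition A) (θ : Θ) :
    (evidence M prior D)⁻¹ * likelihood M D θ ≠ ∞ :=
  ENNReal.mul_ne_top (ENNReal.inv_ne_top.mpr (evidence_ne_zero M prior D))
    (likelihood_ne_top M D θ)

lemma rnDeriv_bayesPosterior (hprior : prior ≪ lam) {n : ℕ} (D : Fin n → Transition A) :
    (bayesPosterior M prior D).rnDeriv lam =ᵐ[lam]
      fun θ => (evidence M prior D)⁻¹ * likelihood M D θ * prior.rnDeriv lam θ := by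
  have hd := Measure.measurable_rnDeriv prior lam
  have hw : Measurable fun θ => (evidence M prior D)⁻¹ * likelihood M D θ :=
    (measurable_likelihood_right M D).const_mul _
  have h1 : bayesPosterior M prior D = lam.withDensity
      (fun θ => (evidence M prior D)⁻¹ * likelihood M D θ * prior.rnDeriv lam θ) := by
    rw [bayesPosterior_eq]
    nth_rw 1 [← Measure.withDensity_rnDeriv_eq prior lam hprior]
    rw [← withDensity_mul _ hd hw]
    congr 1; ext θ
    simp [mul_comm]
  nth_rw 1 [h1]
  exact Measure.rnDeriv_withDensity lam (hw.mul hd)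

omit [IsProbabilityMeasure prior] in
lemma bayesPosterior_absolutelyContinuous {n : ℕ} (D : Fin n → Transition A) :
    bayesPosterior M prior D ≪ prior := by
  rw [bayesPosterior_eq]
  exact withDensity_absolutelyContinuous _ _

/-- Rewrites the entropy against the fixed measure `prior`, so that the data enter only through a
jointly measurable integrand; this yields measurability in `D`. -/
lemma entropy_bayesPosterior (hprior : prior ≪ lam) {n : ℕ} (D : Fin n → Transition A) :
    entropy lam (bayesPosterior M prior D) =
      ∫ θ, ((evidence M prior D)⁻¹ * likelihood M D θ).toReal *
        -Real.log ((evidence M prior D)⁻¹ * likelihood M D θ * prior.rnDeriv lam θ).toReal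
        ∂prior := by
  have h1 : entropy lam (bayesPosterior M prior D) = ∫ θ, -Real.log ((evidence M prior D)⁻¹ *
      likelihood M D θ * prior.rnDeriv lam θ).toReal ∂(bayesPosterior M prior D) := by
    refine integral_congr_ae ?_
    filter_upwards [((bayesPosterior_absolutelyContinuous M prior D).trans hprior).ae_le
      (rnDeriv_bayesPosterior M prior lam hprior D)] with θ hθ
    rw [llr, hθ]
  rw [h1]
  nth_rw 1 [bayesPosterior_eq]
  rw [integral_withDensity_eq_integral_toReal_smul
    ((measurable_likelihood_right M D).const_mul _)
    (ae_of_all _ fun θ => (inv_evidence_mul_likelihood_ne_top M prior D θ).lt_top)]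
  rfl

lemma measurable_entropy_bayesPosterior (hprior : prior ≪ lam) (n : ℕ) :
    Measurable fun D : Fin n → Transition A => entropy lam (bayesPosterior M prior D) := by
  simp_rw [entropy_bayesPosterior M prior lam hprior]
  have hw : Measurable fun p : (Fin n → Transition A) × Θ =>
      (evidence M prior p.1)⁻¹ * likelihood M p.1 p.2 :=
    ((measurable_evidence M prior n).comp measurable_fst).inv.mul (measurable_likelihood M n)
  have hd : Measurable fun p : (Fin n → Transition A) × Θ => prior.rnDeriv lam p.2 :=
    (Measure.measurable_rnDeriv prior lam).comp measurable_snd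
  exact (StronglyMeasurable.integral_prod_right' (ν := prior) (Measurable.stronglyMeasurable
    (hw.ennreal_toReal.mul (hw.mul hd).ennreal_toReal.log.neg))).measurable

lemma measurable_infoGain (hprior : prior ≪ lam) (n : ℕ) :
    Measurable fun p : (Fin n → Transition A) × Transition A =>
      infoGain M prior lam p.1 p.2.1.1 p.2.1.2 p.2.2 :=
  ((measurable_entropy_bayesPosterior M prior lam hprior n).comp measurable_fst).sub
    ((measurable_entropy_bayesPosterior M prior lam hprior (n + 1)).comp (measurable_snoc n))

/-- The transition density. -/
def transDensity (x : ℝ × A) (θ : Θ) (y : ℝ) : ℝ := gaussianPDFReal (M.mean θ x) (M.var θ) y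

lemma measurable_transDensity (x : ℝ × A) : Measurable (Function.uncurry (transDensity M x)) :=
  measurable_uncurry_gaussianPDFReal.comp
    ((M.measurable_mean.comp (measurable_fst.prodMk measurable_const)).prodMk
      ((M.measurable_var.comp measurable_fst).prodMk measurable_snd))

lemma transDensity_pos (x : ℝ × A) (θ : Θ) (y : ℝ) : 0 < transDensity M x θ y :=
  gaussianPDFReal_pos _ _ _ (M.var_pos θ).ne'

lemma lintegral_transDensity (x : ℝ × A) (θ : Θ) :
    ∫⁻ y, ENNReal.ofReal (transDensity M x θ y) = 1 :=
  lintegral_gaussianPDFReal_eq_one _ (M.var_pos θ).ne'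

lemma integral_trans (θ : Θ) (x : ℝ × A) (f : ℝ → ℝ) :
    ∫ y, f y ∂(M.trans θ x) = ∫ y, transDensity M x θ y * f y :=
  integral_gaussianReal_eq_integral_smul (M.var_pos θ).ne'

lemma lintegral_trans (θ : Θ) (x : ℝ × A) {f : ℝ → ℝ≥0∞} (hf : Measurable f) :
    ∫⁻ y, f y ∂(M.trans θ x) = ∫⁻ y, f y * ENNReal.ofReal (transDensity M x θ y) := by
  rw [trans_eq_withDensity, lintegral_withDensity_eq_lintegral_mul _
    (measurable_gaussianPDF _ _) hf]
  refine lintegral_congr fun y => ?_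
  rw [Pi.mul_apply, mul_comm]; rfl

lemma lintegral_predictive {n : ℕ} (D : Fin n → Transition A) (h : evidence M prior D ≠ ∞)
    (x : ℝ × A) {f : ℝ → ℝ≥0∞} (hf : Measurable f) :
    ∫⁻ y, f y ∂(predictive M prior D x) =
      ∫⁻ y, f y * ENNReal.ofReal (mixture (bayesPosterior M prior D) (transDensity M x) y) := by
  have := isProbabilityMeasure_bayesPosterior M prior D h
  have hk : Measurable fun θ => M.trans θ x :=
    M.jointKernel.measurable.comp measurable_prodMk_right
  have hG := measurable_transDensity M x
  rw [predictive, Measure.lintegral_bind hk.aemeasurable hf.aemeasurable]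
  simp_rw [lintegral_trans M _ x hf]
  rw [lintegral_lintegral_swap
    ((hf.comp measurable_snd).mul hG.ennreal_ofReal).aemeasurable]
  refine lintegral_congr_ae ?_
  filter_upwards [ae_ofReal_mixture (bayesPosterior M prior D) hG (transDensity_pos M x)
    (lintegral_transDensity M x)] with y hy
  rw [hy, lintegral_const_mul]
  exact (hG.comp measurable_prodMk_right).ennreal_ofReal

/-- The entropy after one more observation, as an integral against the current posterior. -/
lemma infoGain_eq (hprior : prior ≪ lam)
    (hent : ∀ (n : ℕ) (D : Fin n → Transition A),
      Integrable (llr (bayesPosterior M prior D) lam) (bayesPosterior M prior D))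
    {n : ℕ} (D : Fin n → Transition A) (h : evidence M prior D ≠ ∞) (x : ℝ × A) {y : ℝ}
    (hi : Integrable (fun θ => transDensity M x θ y) (bayesPosterior M prior D))
    (hpos : 0 < mixture (bayesPosterior M prior D) (transDensity M x) y) :
    Integrable (fun θ => (llr (bayesPosterior M prior D) lam θ + Real.log (transDensity M x θ y /
        mixture (bayesPosterior M prior D) (transDensity M x) y)) * (transDensity M x θ y /
        mixture (bayesPosterior M prior D) (transDensity M x) y)) (bayesPosterior M prior D) ∧
      infoGain M prior lam D x.1 x.2 y =
        -(∫ θ, llr (bayesPosterior M prior D) lam θ ∂(bayesPosterior M prior D)) +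
        ∫ θ, (llr (bayesPosterior M prior D) lam θ + Real.log (transDensity M x θ y /
        mixture (bayesPosterior M prior D) (transDensity M x) y)) * (transDensity M x θ y /
        mixture (bayesPosterior M prior D) (transDensity M x) y) ∂(bayesPosterior M prior D) := by
  set q := bayesPosterior M prior D with hq
  set z := mixture q (transDensity M x) y with hz
  set D' : Fin (n + 1) → Transition A := Fin.snoc D (x, y) with hD'
  have hpm := isProbabilityMeasure_bayesPosterior M prior D h
  have he0 := evidence_ne_zero M prior D
  have hgm : Measurable fun θ => transDensity M x θ y :=
    (measurable_transDensity M x).comp measurable_prodMk_right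
  have hw : Measurable fun θ => ENNReal.ofReal (transDensity M x θ y / z) :=
    (hgm.div_const z).ennreal_ofReal
  have hL' : ∀ θ, likelihood M D' θ =
      likelihood M D θ * ENNReal.ofReal (transDensity M x θ y) := fun θ =>
    likelihood_snoc M D (x, y) θ
  have hz' : ENNReal.ofReal z = ∫⁻ θ, ENNReal.ofReal (transDensity M x θ y) ∂q :=
    ofReal_integral_eq_lintegral_ofReal hi (ae_of_all _ fun θ => (transDensity_pos M x θ y).le)
  have hev : evidence M prior D' = evidence M prior D * ENNReal.ofReal z := by
    rw [hz', hq, lintegral_bayesPosterior M prior D hgm.ennreal_ofReal, ← mul_assoc,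
      ENNReal.mul_inv_cancel he0 h, one_mul]
    exact lintegral_congr fun θ => hL' θ
  have hwt : ∀ θ, (evidence M prior D')⁻¹ * likelihood M D' θ =
      (evidence M prior D)⁻¹ * likelihood M D θ * ENNReal.ofReal (transDensity M x θ y / z) := by
    intro θ
    rw [hev, hL', ENNReal.mul_inv (Or.inl he0) (Or.inl h), ENNReal.ofReal_div_of_pos hpos,
      div_eq_mul_inv]
    ring
  -- Bayes' rule is sequential: one more observation reweights the current posterior by
  -- `transDensity / z`, the evidence having gained the factor `z`.
  have hq' : bayesPosterior M prior D' =
      q.withDensity (fun θ => ENNReal.ofReal (transDensity M x θ y / z)) := by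
    rw [bayesPosterior_eq, hq, bayesPosterior_eq, ← withDensity_mul _
      ((measurable_likelihood_right M D).const_mul _) hw]
    congr 1; ext θ
    rw [hwt]; rfl
  have hac : q ≪ lam := (bayesPosterior_absolutelyContinuous M prior D).trans hprior
  have hllr : llr (bayesPosterior M prior D') lam =ᵐ[q]
      fun θ => llr q lam θ + Real.log (transDensity M x θ y / z) := by
    filter_upwards [hac.ae_le (rnDeriv_bayesPosterior M prior lam hprior D),
      hac.ae_le (rnDeriv_bayesPosterior M prior lam hprior D'),
      hac.ae_le (Measure.rnDeriv_lt_top prior lam),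
      (bayesPosterior_absolutelyContinuous M prior D).ae_le (Measure.rnDeriv_pos hprior)]
      with θ h1 h2 h3 h4
    rw [llr, llr, h1, h2, hwt, mul_right_comm, ENNReal.toReal_mul, Real.log_mul]
    · rw [ENNReal.toReal_ofReal (div_pos (transDensity_pos M x θ y) hpos).le]
    · refine (ENNReal.toReal_pos (mul_ne_zero (mul_ne_zero (ENNReal.inv_ne_zero.mpr h)
        (likelihood_ne_zero M D θ)) h4.ne') (ENNReal.mul_ne_top
        (inv_evidence_mul_likelihood_ne_top M prior D θ) h3.ne)).ne'
    · rw [ENNReal.toReal_ofReal (div_pos (transDensity_pos M x θ y) hpos).le]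
      exact (div_pos (transDensity_pos M x θ y) hpos).ne'
  have hllr' : llr (bayesPosterior M prior D') lam =ᵐ[bayesPosterior M prior D']
      fun θ => llr q lam θ + Real.log (transDensity M x θ y / z) := by
    rw [hq']
    rw [hq'] at hllr
    exact (withDensity_absolutelyContinuous _ _).ae_le hllr
  have htr : ∀ θ, (ENNReal.ofReal (transDensity M x θ y / z)).toReal =
      transDensity M x θ y / z := fun θ =>
    ENNReal.toReal_ofReal (div_pos (transDensity_pos M x θ y) hpos).le
  constructor
  -- Integrability is the finiteness of the entropy of the updated posterior, read through the
  -- reweighting.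
  · have h1 := (hent (n + 1) D').congr hllr'
    rw [hq', integrable_withDensity_iff_integrable_smul' hw
      (ae_of_all _ fun _ => ENNReal.ofReal_lt_top)] at h1
    refine h1.congr (ae_of_all _ fun θ => ?_)
    simp only [htr, smul_eq_mul]
    ring
  · have h1 : entropy lam (bayesPosterior M prior D') =
        -∫ θ, (llr q lam θ + Real.log (transDensity M x θ y / z)) *
          (transDensity M x θ y / z) ∂q := by
      rw [entropy, integral_neg, integral_congr_ae hllr', hq',
        integral_withDensity_eq_integral_toReal_smul hw
          (ae_of_all _ fun _ => ENNReal.ofReal_lt_top)]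
      congr 1
      refine integral_congr_ae (ae_of_all _ fun θ => ?_)
      simp only [htr, smul_eq_mul]
      ring
    have h2 : infoGain M prior lam D x.1 x.2 y =
      entropy lam q - entropy lam (bayesPosterior M prior D') := rfl
    rw [h2, h1, entropy, integral_neg]
    ring

/-- The expected information gain under the predictive law is the mutual information. -/
lemma enorm_integral_mixture_mul_infoGain (hprior : prior ≪ lam)
    (hent : ∀ (n : ℕ) (D : Fin n → Transition A),
      Integrable (llr (bayesPosterior M prior D) lam) (bayesPosterior M prior D))
    {n : ℕ} (D : Fin n → Transition A) (h : evidence M prior D ≠ ∞) (x : ℝ × A)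
    (hint : Integrable (fun y => mixture (bayesPosterior M prior D) (transDensity M x) y *
      infoGain M prior lam D x.1 x.2 y)) :
    ‖∫ y, mixture (bayesPosterior M prior D) (transDensity M x) y *
      infoGain M prior lam D x.1 x.2 y‖ₑ =
      mutualInfo (bayesPosterior M prior D) (transDensity M x) := by
  have := isProbabilityMeasure_bayesPosterior M prior D h
  have hG := measurable_transDensity M x
  have hG0 := transDensity_pos M x
  have hG1 := lintegral_transDensity M x
  have key : ∀ᵐ y, Integrable (fun θ => transDensity M x θ y) (bayesPosterior M prior D) ∧
      0 < mixture (bayesPosterior M prior D) (transDensity M x) y := by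
    filter_upwards [ae_integrable_density (bayesPosterior M prior D) hG hG0 hG1,
      ae_mixture_pos (bayesPosterior M prior D) hG hG0 hG1] with y h1 h2
    exact ⟨h1, h2⟩
  exact enorm_integral_mixture_mul _ hG hG0 hG1 (measurable_llr _ _) (hent n D) hint
    (key.mono fun y hy => (infoGain_eq M prior lam hprior hent D h x hy.1 hy.2).1)
    (key.mono fun y hy => (infoGain_eq M prior lam hprior hent D h x hy.1 hy.2).2)

end InformationGain

/-! ### The expected information gain vanishes -/

section Vanishing

variable {A Θ : Type*} [MeasurableSpace A] [MeasurableSpace Θ] (M : GaussianDynamics A Θ)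
  (prior lam : Measure Θ) [IsProbabilityMeasure prior] [SigmaFinite lam]
  (ρ : (n : ℕ) → Kernel (Fin n → Transition A) (ℝ × A)) [∀ n, IsMarkovKernel (ρ n)]

lemma bayesPosterior_zero (D : Fin 0 → Transition A) : bayesPosterior M prior D = prior := by
  have : likelihood M D = 1 := by ext θ; simp [likelihood]
  simp [bayesPosterior, this]

/-- The second moment of the information gain, under the true law plus the predictive law. -/
def gainMoment (θ₀ : Θ) {n : ℕ} (D : Fin n → Transition A) (x : ℝ × A) : ℝ≥0∞ :=
  ∫⁻ s', ‖infoGain M prior lam D x.1 x.2 s'‖ₑ ^ 2 ∂(M.trans θ₀ x + predictive M prior D x)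

lemma measurable_infoGain_right (hprior : prior ≪ lam) {n : ℕ} (D : Fin n → Transition A)
    (x : ℝ × A) : Measurable (infoGain M prior lam D x.1 x.2) :=
  Measurable.comp (g := fun p : (Fin n → Transition A) × Transition A =>
      infoGain M prior lam p.1 p.2.1.1 p.2.1.2 p.2.2) (f := fun y => (D, (x, y)))
    (measurable_infoGain M prior lam hprior n)
    (measurable_const.prodMk (measurable_const.prodMk measurable_id))

lemma gainMoment_eq (hprior : prior ≪ lam) (θ₀ : Θ) {n : ℕ} (D : Fin n → Transition A)
    (h : evidence M prior D ≠ ∞) (x : ℝ × A) :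
    gainMoment M prior lam θ₀ D x =
      (∫⁻ y, ‖infoGain M prior lam D x.1 x.2 y‖ₑ ^ 2 * ENNReal.ofReal (transDensity M x θ₀ y)) +
      ∫⁻ y, ‖infoGain M prior lam D x.1 x.2 y‖ₑ ^ 2 *
        ENNReal.ofReal (mixture (bayesPosterior M prior D) (transDensity M x) y) := by
  have hm : Measurable fun y => ‖infoGain M prior lam D x.1 x.2 y‖ₑ ^ 2 :=
    (measurable_infoGain_right M prior lam hprior D x).enorm.pow_const 2
  rw [gainMoment, lintegral_add_measure, lintegral_trans M θ₀ x hm,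
    lintegral_predictive M prior D h x hm]

/-- A crude bound that needs no concentration of the posterior. It serves on the exceptional data
sets and, with `τ = 1`, as the domination over state-action pairs. -/
lemma enorm_integral_infoGain_le_moment (hprior : prior ≪ lam) (θ₀ : Θ) {n : ℕ}
    (D : Fin n → Transition A) (x : ℝ × A) {τ : ℝ} (hτ : 0 < τ) :
    ∫⁻ y, ‖infoGain M prior lam D x.1 x.2 y‖ₑ ∂(M.trans θ₀ x) ≤
      ENNReal.ofReal τ * gainMoment M prior lam θ₀ D x + ENNReal.ofReal τ⁻¹ := by
  have hg := measurable_infoGain_right M prior lam hprior D x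
  have h1 := lintegral_enorm_mul_density_le (g := transDensity M x θ₀)
    (h := infoGain M prior lam D x.1 x.2)
    ((measurable_transDensity M x).comp measurable_prodMk_left)
    (fun y => (transDensity_pos M x θ₀ y).le) (lintegral_transDensity M x θ₀) hτ
  rw [← lintegral_trans M θ₀ x (hg.enorm.pow_const 2)] at h1
  rw [lintegral_trans M θ₀ x hg.enorm]
  calc _ = ∫⁻ y, ‖transDensity M x θ₀ y * infoGain M prior lam D x.1 x.2 y‖ₑ := by
        refine lintegral_congr fun y => ?_
        rw [enorm_mul, mul_comm, Real.enorm_of_nonneg (transDensity_pos M x θ₀ y).le]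
    _ ≤ _ := h1
    _ ≤ _ := by
        gcongr
        rw [gainMoment, lintegral_add_measure]
        exact le_self_add

/-- The mutual information of the prior and one observation is finite. -/
lemma mutualInfo_prior_ne_top (hprior : prior ≪ lam)
    (hent : ∀ (n : ℕ) (D : Fin n → Transition A),
      Integrable (llr (bayesPosterior M prior D) lam) (bayesPosterior M prior D))
    {θ₀ : Θ} (hIG : BoundedInfoGain M prior lam ρ θ₀) (x : ℝ × A) :
    mutualInfo prior (transDensity M x) ≠ ∞ := by
  obtain ⟨C, hC⟩ := hIG
  -- For the empty data set the posterior is the prior and the moment bound, an average over a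
  -- single point, holds for that point.
  set D : Fin 0 → Transition A := default
  have hq : bayesPosterior M prior D = prior := bayesPosterior_zero M prior D
  have hev : evidence M prior D ≠ ∞ := by simp [evidence, likelihood]
  have hS : gainMoment M prior lam θ₀ D x ≠ ∞ := by
    have := hC 0 x.1 x.2
    rw [lintegral_unique] at this
    simp only [measure_univ, mul_one] at this
    exact (this.trans_lt ENNReal.coe_lt_top).ne
  have hG := measurable_transDensity M x
  have hG0 := transDensity_pos M x
  have hG1 := lintegral_transDensity M x
  have hg := measurable_infoGain_right M prior lam hprior D x
  have hint : Integrable (fun y => mixture prior (transDensity M x) y *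
      infoGain M prior lam D x.1 x.2 y) := by
    refine ⟨((measurable_mixture prior hG).mul hg).aestronglyMeasurable, ?_⟩
    refine (lintegral_enorm_mul_density_le (measurable_mixture prior hG)
      (fun y => integral_nonneg fun θ => (hG0 θ y).le) (lintegral_mixture prior hG hG0 hG1)
      one_pos).trans_lt ?_
    rw [gainMoment_eq M prior lam hprior θ₀ D hev, hq] at hS
    simpa using (ENNReal.add_ne_top.mp hS).2.lt_top
  have := enorm_integral_mixture_mul_infoGain M prior lam hprior hent D hev x (by rwa [hq])
  rw [hq] at this
  rw [← this]
  exact enorm_ne_top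

/-- A bound on the expected information gain under the true dynamics in terms of the concentration
of the posterior. -/
lemma enorm_integral_infoGain_le (hprior : prior ≪ lam)
    (hent : ∀ (n : ℕ) (D : Fin n → Transition A),
      Integrable (llr (bayesPosterior M prior D) lam) (bayesPosterior M prior D))
    (θ₀ : Θ) {n : ℕ} (D : Fin n → Transition A) (h : evidence M prior D ≠ ∞) (x : ℝ × A)
    {α : ℝ} (hα : 0 < α) (hα1 : α ≤ 1) {F : Set Θ} (hF : MeasurableSet F)
    (hκ : ∀ θ ∉ F, ∫⁻ y, ENNReal.ofReal (relEnt (transDensity M x θ y) (transDensity M x θ₀ y)) ≤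
      ENNReal.ofReal α)
    (hfar : ∫⁻ θ in F, ((∫⁻ y, ENNReal.ofReal (relEnt (transDensity M x θ y)
      (mixture prior (transDensity M x) y))) + 1 + ENNReal.ofReal (Real.log α⁻¹))
      ∂(bayesPosterior M prior D) ≤ ENNReal.ofReal α) {τ : ℝ} (hτ : 0 < τ) :
    ‖∫ y, infoGain M prior lam D x.1 x.2 y ∂(M.trans θ₀ x)‖ₑ ≤
      ENNReal.ofReal ((3 + 8 * τ⁻¹) * α) +
        ENNReal.ofReal (2 * τ) * gainMoment M prior lam θ₀ D x := by
  have := isProbabilityMeasure_bayesPosterior M prior D h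
  have hG := measurable_transDensity M x
  have hG0 := transDensity_pos M x
  have hG1 := lintegral_transDensity M x
  have hmix := measurable_mixture prior hG
  have hmix0 : ∀ y, 0 ≤ mixture prior (transDensity M x) y := fun y =>
    integral_nonneg fun θ => (hG0 θ y).le
  -- The near part, the contamination and the far part contribute `α` each, so `B = 3 α`. Then `B +
  -- τ⁻¹ (2 B + 2 α) = (3 + 8 τ⁻¹) α`.
  have hB := (lintegral_relEnt_contaminated_le (bayesPosterior M prior D) hG hG0 hG1 prior θ₀
    hα hα1 hF hκ).trans (add_le_add_right hfar _)
  have key := enorm_integral_density_mul_le (bayesPosterior M prior D) hG hG0 hG1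
    (measurable_infoGain_right M prior lam hprior D x) θ₀
    (m := fun y => transDensity M x θ₀ y + α * mixture prior (transDensity M x) y)
    ((hG.comp measurable_prodMk_left).add (hmix.const_mul α))
    (ae_of_all _ fun y => le_add_of_nonneg_right (mul_nonneg hα.le (hmix0 y)))
    (enorm_integral_mixture_mul_infoGain M prior lam hprior hent D h x) hτ hB
  have hα' : ∫⁻ y, ENNReal.ofReal (transDensity M x θ₀ y + α * mixture prior (transDensity M x) y -
      transDensity M x θ₀ y) = ENNReal.ofReal α := by
    simp_rw [add_sub_cancel_left, ENNReal.ofReal_mul hα.le]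
    rw [lintegral_const_mul' _ _ ENNReal.ofReal_ne_top, lintegral_mixture prior hG hG0 hG1, mul_one]
  rw [hα', ← gainMoment_eq M prior lam hprior θ₀ D h x, ← integral_trans] at key
  refine key.trans (le_of_eq ?_)
  rw [add_right_comm]
  congr 1
  have hτ' : 0 < τ⁻¹ := inv_pos.mpr hτ
  rw [show (2 : ℝ≥0∞) = ENNReal.ofReal 2 by simp, ← ENNReal.ofReal_add hα.le hα.le,
    ← ENNReal.ofReal_add (by positivity) hα.le, ← ENNReal.ofReal_mul zero_le_two,
    ← ENNReal.ofReal_mul zero_le_two, ← ENNReal.ofReal_add (by positivity) (by positivity),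
    ← ENNReal.ofReal_mul hτ'.le, ← ENNReal.ofReal_add (by positivity) (by positivity)]
  congr 1
  ring

/-- The expected information gain at a fixed state-action pair vanishes in mean. -/
theorem tendsto_lintegral_enorm_integral_infoGain [PseudoMetricSpace Θ] [OpensMeasurableSpace Θ]
    {θ₀ : Θ} (hmean : ∀ x : ℝ × A, ContinuousAt (fun θ => M.mean θ x) θ₀)
    (hvar : ContinuousAt M.var θ₀) (hprior : prior ≪ lam)
    (hKL : KLSupport M prior ρ θ₀) (htest : Testable M ρ θ₀)
    (hent : ∀ (n : ℕ) (D : Fin n → Transition A),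
      Integrable (llr (bayesPosterior M prior D) lam) (bayesPosterior M prior D))
    (hIG : BoundedInfoGain M prior lam ρ θ₀) (x : ℝ × A) :
    Tendsto (fun n => ∫⁻ D, ‖∫ y, infoGain M prior lam D x.1 x.2 y ∂(M.trans θ₀ x)‖ₑ
      ∂(dataLaw M ρ θ₀ n)) atTop (𝓝 0) := by
  have hI := mutualInfo_prior_ne_top M prior lam ρ hprior hent hIG x
  obtain ⟨C, hC⟩ := hIG
  have hG := measurable_transDensity M x
  have hmix := measurable_mixture prior hG
  rw [ENNReal.tendsto_nhds_zero]
  intro e he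
  obtain ⟨ε, hε0, hε⟩ : ∃ ε : ℝ, 0 < ε ∧ ENNReal.ofReal (3 * ε) ≤ e := by
    by_cases ht : e = ∞
    · exact ⟨1, one_pos, by simp [ht]⟩
    · refine ⟨e.toReal / 3, div_pos (ENNReal.toReal_pos he.ne' ht) three_pos, ?_⟩
      rw [mul_div_cancel₀ _ three_ne_zero, ENNReal.ofReal_toReal ht]
  -- First `τ` is chosen so that the moment term stays below `ε`, then `α` so that `(3 + 8 τ⁻¹) α ≤
  -- ε`; finally the bad event gets probability at most `τ * ε`, against a cost `τ⁻¹` on it. The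
  -- three errors total `3 * ε`.
  set τ : ℝ := ε / (2 * (C + 1)) with hτ
  have hτ0 : 0 < τ := by positivity
  have hτC : 2 * τ * C ≤ ε := by
    have : 2 * τ * (C + 1) = ε := by rw [hτ]; field_simp
    nlinarith
  set α : ℝ := min 1 (ε / (3 + 8 * τ⁻¹)) with hα
  have hα0 : 0 < α := by positivity
  have hα1 : α ≤ 1 := min_le_left _ _
  have hατ : (3 + 8 * τ⁻¹) * α ≤ ε := by
    calc (3 + 8 * τ⁻¹) * α ≤ (3 + 8 * τ⁻¹) * (ε / (3 + 8 * τ⁻¹)) := by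
          gcongr; exact min_le_right _ _
      _ = ε := by field_simp
  obtain ⟨r, hr, hnear⟩ : ∃ r : ℝ, 0 < r ∧ ∀ θ, ¬ r < dist θ θ₀ →
      ∫⁻ y, ENNReal.ofReal (relEnt (transDensity M x θ y) (transDensity M x θ₀ y)) ≤
        ENNReal.ofReal α := by
    have h1 := tendsto_lintegral_relEnt_gaussianPDFReal (hmean x) hvar
      (fun θ => (M.var_pos θ).ne') (M.var_pos θ₀).ne'
    have h2 := (ENNReal.tendsto_nhds_zero.mp h1) (ENNReal.ofReal α) (by simpa using hα0)
    obtain ⟨r, hr, h3⟩ := Metric.eventually_nhds_iff.mp h2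
    -- Halving turns the open ball of the neighbourhood filter into the closed ball that is the
    -- complement of the far set.
    exact ⟨r / 2, half_pos hr, fun θ hθ => h3 (by linarith [not_lt.mp hθ])⟩
  set k : Θ → ℝ≥0∞ := fun θ => (∫⁻ y, ENNReal.ofReal (relEnt (transDensity M x θ y)
      (mixture prior (transDensity M x) y))) + 1 + ENNReal.ofReal (Real.log α⁻¹) with hk
  have hrm : Measurable fun p : Θ × ℝ => ENNReal.ofReal (relEnt (transDensity M x p.1 p.2)
      (mixture prior (transDensity M x) p.2)) :=
    (measurable_relEnt hG (hmix.comp measurable_snd)).ennreal_ofReal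
  have hkm : Measurable k := (hrm.lintegral_prod_right'.add_const _).add_const _
  have hki : ∫⁻ θ, k θ ∂prior ≠ ∞ := by
    rw [lintegral_add_right _ measurable_const, lintegral_add_right _ measurable_const,
      lintegral_lintegral_swap hrm.aemeasurable]
    simp only [lintegral_const, measure_univ, mul_one]
    exact ENNReal.add_ne_top.mpr ⟨ENNReal.add_ne_top.mpr ⟨hI, ENNReal.one_ne_top⟩,
      ENNReal.ofReal_ne_top⟩
  have hbad := tendsto_measure_posterior_far M prior ρ hKL htest hkm hki hr hα0
  have hbad' := ENNReal.tendsto_nhds_zero.mp hbad (ENNReal.ofReal (τ * ε))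
    (by simpa using mul_pos hτ0 hε0)
  filter_upwards [hbad'] with n hn
  -- A measurable hull of the same measure replaces the bad event, so its measurability need not be
  -- checked.
  set bad : Set (Fin n → Transition A) := toMeasurable (dataLaw M ρ θ₀ n) {D | ENNReal.ofReal α ≤
      ∫⁻ θ in {θ | r < dist θ θ₀}, k θ ∂(bayesPosterior M prior D)} with hbaddef
  have hbm : MeasurableSet bad := measurableSet_toMeasurable _ _
  have hfarm : MeasurableSet {θ | r < dist θ θ₀} :=
    (isOpen_lt continuous_const (continuous_id.dist continuous_const)).measurableSet
  calc ∫⁻ D, ‖∫ y, infoGain M prior lam D x.1 x.2 y ∂(M.trans θ₀ x)‖ₑ ∂(dataLaw M ρ θ₀ n)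
      ≤ ∫⁻ D, (ENNReal.ofReal ε + ENNReal.ofReal (2 * τ) * gainMoment M prior lam θ₀ D x +
          bad.indicator (fun _ => ENNReal.ofReal τ⁻¹) D) ∂(dataLaw M ρ θ₀ n) := by
        refine lintegral_mono_ae ?_
        filter_upwards [ae_evidence_ne_top M prior ρ θ₀ n] with D hD
        by_cases hDb : D ∈ bad
        · rw [Set.indicator_of_mem hDb]
          refine (enorm_integral_le_lintegral_enorm _).trans
            ((enorm_integral_infoGain_le_moment M prior lam hprior θ₀ D x hτ0).trans ?_)
          gcongr
          refine le_add_left ?_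
          gcongr
          linarith
        · rw [Set.indicator_of_notMem hDb, add_zero]
          have hDk : ∫⁻ θ in {θ | r < dist θ θ₀}, k θ ∂(bayesPosterior M prior D) ≤
              ENNReal.ofReal α := by
            by_contra hcon
            exact hDb (subset_toMeasurable _ _ (not_le.mp hcon).le)
          refine (enorm_integral_infoGain_le M prior lam hprior hent θ₀ D hD x hα0 hα1 hfarm
            (fun θ hθ => hnear θ hθ) hDk hτ0).trans ?_
          gcongr
    _ = ENNReal.ofReal ε + ENNReal.ofReal (2 * τ) *
          (∫⁻ D, gainMoment M prior lam θ₀ D x ∂(dataLaw M ρ θ₀ n)) +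
          ENNReal.ofReal τ⁻¹ * dataLaw M ρ θ₀ n bad := by
        rw [lintegral_add_right _ (measurable_const.indicator hbm),
          lintegral_add_left measurable_const, lintegral_const_mul' _ _ ENNReal.ofReal_ne_top,
          lintegral_indicator_const hbm]
        simp
    _ ≤ ENNReal.ofReal ε + ENNReal.ofReal (2 * τ) * C +
          ENNReal.ofReal τ⁻¹ * ENNReal.ofReal (τ * ε) := by
        gcongr
        · exact hC n x.1 x.2
        · rw [hbaddef, measure_toMeasurable]; exact hn
    _ ≤ ENNReal.ofReal ε + ENNReal.ofReal ε + ENNReal.ofReal ε := by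
        gcongr
        · rw [← ENNReal.ofReal_coe_nnreal, ← ENNReal.ofReal_mul (by positivity)]
          exact ENNReal.ofReal_le_ofReal hτC
        · rw [← ENNReal.ofReal_mul (by positivity), ← mul_assoc, inv_mul_cancel₀ hτ0.ne', one_mul]
    _ = ENNReal.ofReal (3 * ε) := by
        rw [← ENNReal.ofReal_add hε0.le hε0.le, ← ENNReal.ofReal_add (by positivity) hε0.le]
        congr 1; ring
    _ ≤ e := hε

end Vanishing

/-! ### Stability of values under a change of reward -/

section ValueComparison

/-- No integrability of `w` is needed: if the right side is finite, `w` differs from `u` by an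
integrable function; otherwise the claim is void. Hence the value bounds hold for every data set,
even where the augmented reward is not integrable and integrals take the default value `0`. -/
lemma enorm_integral_sub_integral_le {X : Type*} [MeasurableSpace X] {μ : Measure X}
    {u w : X → ℝ} (hu : Integrable u μ) (hw : AEStronglyMeasurable w μ) :
    ‖∫ x, w x ∂μ - ∫ x, u x ∂μ‖ₑ ≤ ∫⁻ x, ‖w x - u x‖ₑ ∂μ := by
  by_cases h : ∫⁻ x, ‖w x - u x‖ₑ ∂μ = ∞
  · rw [h]; exact le_top
  have hd : Integrable (fun x => w x - u x) μ :=
    ⟨hw.sub hu.aestronglyMeasurable, lt_top_iff_ne_top.mpr h⟩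
  have hwi : Integrable w μ := (hd.add hu).congr (ae_of_all _ fun x => by simp)
  rw [← integral_sub hwi hu]
  exact enorm_integral_le_lintegral_enorm _

lemma enorm_tsum_sub_tsum_le {u w : ℕ → ℝ} (hu : Summable u) :
    ‖∑' t, w t - ∑' t, u t‖ₑ ≤ ∑' t, ‖w t - u t‖ₑ := by
  by_cases h : ∑' t, ‖w t - u t‖ₑ = ∞
  · rw [h]; exact le_top
  have hd : Summable fun t => w t - u t := by
    rw [← summable_norm_iff]
    have := ENNReal.summable_toReal h
    simpa using this
  have hw : Summable w := (hd.add hu).congr fun t => by simp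
  rw [← hw.tsum_sub hu]
  exact enorm_tsum_le_tsum_enorm

lemma summable_discounted {γ K : ℝ} (hγ0 : 0 < γ) (hγ1 : γ < 1) {g : ℕ → ℝ} (hg : ∀ t, |g t| ≤ K) :
    Summable fun t : ℕ => γ ^ t * g t :=
  Summable.of_norm_bounded ((summable_geometric_of_lt_one hγ0.le hγ1).mul_right K) fun t => by
    rw [norm_mul, Real.norm_of_nonneg (pow_nonneg hγ0.le t)]
    exact mul_le_mul_of_nonneg_left (hg t) (pow_nonneg hγ0.le t)

variable {A : Type*} [MeasurableSpace A] (P : Kernel (ℝ × A) ℝ) [IsMarkovKernel P]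
  (pol : Kernel ℝ A) [IsMarkovKernel pol]

/-- The mean of the reward over the next state. -/
def meanReward (r : ℝ → A → ℝ → ℝ) (x : ℝ × A) : ℝ := ∫ s', r x.1 x.2 s' ∂(P x)

/-- The law of the state-action pair at time `t`, from a given initial state. -/
def occupation : ℕ → Kernel ℝ (ℝ × A)
  | 0 => Kernel.id ×ₖ pol
  | t + 1 => occupation t ∘ₖ (P ∘ₖ (Kernel.id ×ₖ pol))

instance isMarkovKernel_occupation (t : ℕ) : IsMarkovKernel (occupation P pol t) := by
  induction t with
  | zero => unfold occupation; infer_instance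
  | succ t ih => unfold occupation; infer_instance

omit [IsMarkovKernel P] in
lemma lintegral_occupation_zero (s : ℝ) {f : ℝ × A → ℝ≥0∞} (hf : Measurable f) :
    ∫⁻ x, f x ∂(occupation P pol 0 s) = ∫⁻ a, f (s, a) ∂(pol s) :=
  Kernel.lintegral_id_prod hf pol s

omit [IsMarkovKernel P] in
lemma lintegral_occupation_succ (t : ℕ) (s : ℝ) {f : ℝ × A → ℝ≥0∞} (hf : Measurable f) :
    ∫⁻ x, f x ∂(occupation P pol (t + 1) s) =
      ∫⁻ a, ∫⁻ s', ∫⁻ x, f x ∂(occupation P pol t s') ∂(P (s, a)) ∂(pol s) := by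
  have h1 : Measurable fun s' => ∫⁻ x, f x ∂(occupation P pol t s') := hf.lintegral_kernel
  rw [occupation, Kernel.lintegral_comp _ _ _ hf, Kernel.lintegral_comp _ _ _ h1,
    Kernel.lintegral_id_prod h1.lintegral_kernel]

variable {γ : ℝ} {r r₀ : ℝ → A → ℝ → ℝ} {K : ℝ}

lemma measurable_meanReward (hr : Measurable (fun p : (ℝ × A) × ℝ => r p.1.1 p.1.2 p.2)) :
    Measurable (meanReward P r) :=
  (StronglyMeasurable.integral_kernel_prod_right' (κ := P) hr.stronglyMeasurable).measurable

/-- Induction on `t`, peeling off the first transition; `occupation` is defined with the same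
recursion so that the two sides match. Only the reference reward `r₀` has to be bounded. -/
lemma enorm_expectedReward_sub_le
    (hr : Measurable (fun p : (ℝ × A) × ℝ => r p.1.1 p.1.2 p.2))
    (hr₀ : Measurable (fun p : (ℝ × A) × ℝ => r₀ p.1.1 p.1.2 p.2))
    (hK : ∀ s a s', |r₀ s a s'| ≤ K) (t : ℕ) (s : ℝ) :
    ‖expectedReward P pol r t s - expectedReward P pol r₀ t s‖ₑ ≤
      ∫⁻ x, ‖meanReward P r x - meanReward P r₀ x‖ₑ ∂(occupation P pol t s) := by
  have hm := measurable_meanReward P hr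
  have hm₀ := measurable_meanReward P hr₀
  have hd : Measurable fun x => ‖meanReward P r x - meanReward P r₀ x‖ₑ := (hm.sub hm₀).enorm
  have hsec : ∀ s : ℝ, Measurable fun a : A => (s, a) := fun s => measurable_prodMk_left
  induction t generalizing s with
  | zero =>
    rw [lintegral_occupation_zero P pol s hd]
    exact enorm_integral_sub_integral_le
      (Integrable.of_bound (hm₀.comp (hsec s)).aestronglyMeasurable K
        (ae_of_all _ fun a => abs_integral_le_const _ (hK s a)))
      (hm.comp (hsec s)).aestronglyMeasurable
  | succ t ih =>
    rw [lintegral_occupation_succ P pol t s hd]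
    have hE := measurable_expectedReward (P := P) (pol := pol) hr t
    have hE₀ := measurable_expectedReward (P := P) (pol := pol) hr₀ t
    have hb := abs_expectedReward_le (P := P) (pol := pol) hK t
    have hI : ∀ g : ℝ → ℝ, Measurable g → Measurable fun a => ∫ s', g s' ∂(P (s, a)) :=
      fun g hg => ((StronglyMeasurable.integral_kernel_prod_right' (κ := P)
        (hg.comp measurable_snd).stronglyMeasurable).measurable).comp (hsec s)
    refine (enorm_integral_sub_integral_le
      (Integrable.of_bound (hI _ hE₀).aestronglyMeasurable K
        (ae_of_all _ fun a => abs_integral_le_const _ hb))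
      (hI _ hE).aestronglyMeasurable).trans (lintegral_mono fun a => ?_)
    refine (enorm_integral_sub_integral_le
      (Integrable.of_bound hE₀.aestronglyMeasurable K (ae_of_all _ hb))
      hE.aestronglyMeasurable).trans (lintegral_mono fun s' => ih s')

/-- The discounted occupation measure of state-action pairs, from an initial state law. -/
def discountedOccupation (γ : ℝ) (μ : Measure ℝ) : Measure (ℝ × A) :=
  Measure.sum fun t : ℕ => ENNReal.ofReal (γ ^ t) • μ.bind (occupation P pol t)

lemma tsum_ofReal_pow_ne_top (hγ0 : 0 < γ) (hγ1 : γ < 1) :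
    ∑' t : ℕ, ENNReal.ofReal (γ ^ t) ≠ ∞ := by
  rw [← ENNReal.ofReal_tsum_of_nonneg (fun t => pow_nonneg hγ0.le t)
    (summable_geometric_of_lt_one hγ0.le hγ1)]
  exact ENNReal.ofReal_ne_top

lemma isFiniteMeasure_discountedOccupation (hγ0 : 0 < γ) (hγ1 : γ < 1) (μ : Measure ℝ)
    [IsProbabilityMeasure μ] : IsFiniteMeasure (discountedOccupation P pol γ μ) := by
  constructor
  rw [discountedOccupation, Measure.sum_apply _ MeasurableSet.univ]
  have : ∀ t, (ENNReal.ofReal (γ ^ t) • μ.bind (occupation P pol t)) Set.univ =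
      ENNReal.ofReal (γ ^ t) := by
    intro t
    rw [Measure.smul_apply, measure_univ, smul_eq_mul, mul_one]
  simp_rw [this]
  exact lt_top_iff_ne_top.mpr (tsum_ofReal_pow_ne_top hγ0 hγ1)

omit [IsMarkovKernel P] [IsMarkovKernel pol] in
lemma lintegral_discountedOccupation (γ : ℝ) (μ : Measure ℝ) {f : ℝ × A → ℝ≥0∞}
    (hf : Measurable f) :
    ∫⁻ x, f x ∂(discountedOccupation P pol γ μ) =
      ∑' t : ℕ, ENNReal.ofReal (γ ^ t) * ∫⁻ s, ∫⁻ x, f x ∂(occupation P pol t s) ∂μ := by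
  rw [discountedOccupation, lintegral_sum_measure]
  refine tsum_congr fun t => ?_
  rw [lintegral_smul_measure, Measure.lintegral_bind (Kernel.aemeasurable _) hf.aemeasurable]
  rfl

variable (hγ0 : 0 < γ) (hγ1 : γ < 1)
  (hr : Measurable (fun p : (ℝ × A) × ℝ => r p.1.1 p.1.2 p.2))
  (hr₀ : Measurable (fun p : (ℝ × A) × ℝ => r₀ p.1.1 p.1.2 p.2))
  (hK : ∀ s a s', |r₀ s a s'| ≤ K)

include hr hr₀ hK

lemma enorm_integral_expectedReward_sub_le (t : ℕ) (μ : Measure ℝ) [IsProbabilityMeasure μ] :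
    ‖∫ s, expectedReward P pol r t s ∂μ - ∫ s, expectedReward P pol r₀ t s ∂μ‖ₑ ≤
      ∫⁻ s, ∫⁻ x, ‖meanReward P r x - meanReward P r₀ x‖ₑ ∂(occupation P pol t s) ∂μ :=
  (enorm_integral_sub_integral_le
    (Integrable.of_bound (measurable_expectedReward hr₀ t).aestronglyMeasurable K
      (ae_of_all _ (abs_expectedReward_le hK t)))
    (measurable_expectedReward hr t).aestronglyMeasurable).trans
    (lintegral_mono fun s => enorm_expectedReward_sub_le P pol hr hr₀ hK t s)

include hγ0

lemma enorm_discountedReturn_sub_le (μ : Measure ℝ) [IsProbabilityMeasure μ] (T : ℕ) :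
    ‖discountedReturn P pol μ γ r T - discountedReturn P pol μ γ r₀ T‖ₑ ≤
      ∫⁻ x, ‖meanReward P r x - meanReward P r₀ x‖ₑ ∂(discountedOccupation P pol γ μ) := by
  have hd : Measurable fun x => ‖meanReward P r x - meanReward P r₀ x‖ₑ :=
    ((measurable_meanReward P hr).sub (measurable_meanReward P hr₀)).enorm
  rw [lintegral_discountedOccupation P pol γ μ hd, discountedReturn, discountedReturn,
    ← Finset.sum_sub_distrib]
  refine (enorm_sum_le _ _).trans (le_trans (Finset.sum_le_sum fun t _ => ?_)
    (ENNReal.sum_le_tsum (Finset.range (T + 1))))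
  rw [← mul_sub, enorm_mul, Real.enorm_of_nonneg (pow_nonneg hγ0.le t)]
  gcongr
  exact enorm_integral_expectedReward_sub_le P pol hr hr₀ hK t μ

include hγ1

lemma enorm_discountedReturnInf_sub_le (μ : Measure ℝ) [IsProbabilityMeasure μ] :
    ‖discountedReturnInf P pol μ γ r - discountedReturnInf P pol μ γ r₀‖ₑ ≤
      ∫⁻ x, ‖meanReward P r x - meanReward P r₀ x‖ₑ ∂(discountedOccupation P pol γ μ) := by
  have hd : Measurable fun x => ‖meanReward P r x - meanReward P r₀ x‖ₑ :=
    ((measurable_meanReward P hr).sub (measurable_meanReward P hr₀)).enorm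
  rw [lintegral_discountedOccupation P pol γ μ hd, discountedReturnInf, discountedReturnInf]
  refine (enorm_tsum_sub_tsum_le (summable_discounted hγ0 hγ1 fun t =>
    abs_integral_le_const _ (abs_expectedReward_le hK t))).trans
    (ENNReal.tsum_le_tsum fun t => ?_)
  rw [← mul_sub, enorm_mul, Real.enorm_of_nonneg (pow_nonneg hγ0.le t)]
  gcongr
  exact enorm_integral_expectedReward_sub_le P pol hr hr₀ hK t μ

/-- The state value is the infinite-horizon return started from a Dirac mass. -/
lemma enorm_stateValue_sub_le (s : ℝ) :
    ‖stateValue P pol γ r s - stateValue P pol γ r₀ s‖ₑ ≤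
      ∫⁻ x, ‖meanReward P r x - meanReward P r₀ x‖ₑ
        ∂(discountedOccupation P pol γ (Measure.dirac s)) := by
  have hs : ∀ r' : ℝ → A → ℝ → ℝ, stateValue P pol γ r' s =
      discountedReturnInf P pol (Measure.dirac s) γ r' := fun r' => by
    simp [stateValue, discountedReturnInf]
  rw [hs, hs]
  exact enorm_discountedReturnInf_sub_le P pol hγ0 hγ1 hr hr₀ hK _

/-- The first reward is collected at `(s, a)` itself, hence the Dirac mass; the rest is a state
value averaged over `P (s, a)`, discounted once more. -/
lemma enorm_actionValue_sub_le (s : ℝ) (a : A) :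
    ‖actionValue P pol γ r s a - actionValue P pol γ r₀ s a‖ₑ ≤
      ∫⁻ x, ‖meanReward P r x - meanReward P r₀ x‖ₑ ∂(Measure.dirac (s, a) +
        ENNReal.ofReal γ • discountedOccupation P pol γ (P (s, a))) := by
  have hd : Measurable fun x => ‖meanReward P r x - meanReward P r₀ x‖ₑ :=
    ((measurable_meanReward P hr).sub (measurable_meanReward P hr₀)).enorm
  have hV : ∀ r' : ℝ → A → ℝ → ℝ, Measurable (fun p : (ℝ × A) × ℝ => r' p.1.1 p.1.2 p.2) →
      Measurable (stateValue P pol γ r') := fun r' hr' =>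
    Measurable.tsum fun t => (measurable_expectedReward hr' t).const_mul _
  have hVb : ∀ s, |stateValue P pol γ r₀ s| ≤ ∑' t : ℕ, γ ^ t * K := fun s =>
    tsum_of_norm_bounded (f := fun t => γ ^ t * expectedReward P pol r₀ t s)
      ((summable_geometric_of_lt_one hγ0.le hγ1).mul_right K).hasSum fun t => by
      rw [norm_mul, Real.norm_of_nonneg (pow_nonneg hγ0.le t)]
      exact mul_le_mul_of_nonneg_left (abs_expectedReward_le hK t s) (pow_nonneg hγ0.le t)
  rw [lintegral_add_measure, lintegral_dirac' _ hd, lintegral_smul_measure,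
    lintegral_discountedOccupation P pol γ _ hd]
  have h1 : actionValue P pol γ r s a - actionValue P pol γ r₀ s a =
      (meanReward P r (s, a) - meanReward P r₀ (s, a)) +
        γ * (∫ s', stateValue P pol γ r s' ∂(P (s, a)) -
          ∫ s', stateValue P pol γ r₀ s' ∂(P (s, a))) := by
    simp only [actionValue, meanReward]; ring
  rw [h1]
  refine (enorm_add_le _ _).trans (add_le_add_right ?_ _)
  rw [enorm_mul, Real.enorm_of_nonneg hγ0.le, smul_eq_mul]
  gcongr
  refine (enorm_integral_sub_integral_le
    (Integrable.of_bound (hV r₀ hr₀).aestronglyMeasurable _ (ae_of_all _ hVb))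
    (hV r hr).aestronglyMeasurable).trans ?_
  calc _ ≤ ∫⁻ s', ∑' t : ℕ, ENNReal.ofReal (γ ^ t) *
        ∫⁻ x, ‖meanReward P r x - meanReward P r₀ x‖ₑ ∂(occupation P pol t s') ∂(P (s, a)) := by
        refine lintegral_mono fun s' => ?_
        refine (enorm_stateValue_sub_le P pol hγ0 hγ1 hr hr₀ hK s').trans (le_of_eq ?_)
        rw [lintegral_discountedOccupation P pol γ _ hd]
        refine tsum_congr fun t => ?_
        rw [lintegral_dirac' _ hd.lintegral_kernel]
    _ = _ := by
        rw [lintegral_tsum fun t => (hd.lintegral_kernel.const_mul _).aemeasurable]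
        refine tsum_congr fun t => ?_
        rw [lintegral_const_mul _ hd.lintegral_kernel]

end ValueComparison

/-! ### Convergence in probability of the values -/

section Convergence

variable {A Θ : Type*} [MeasurableSpace A] [MeasurableSpace Θ] (M : GaussianDynamics A Θ)
  (prior lam : Measure Θ) [IsProbabilityMeasure prior] [SigmaFinite lam]
  (ρ : (n : ℕ) → Kernel (Fin n → Transition A) (ℝ × A)) [∀ n, IsMarkovKernel (ρ n)]
  {re : ℝ → A → ℝ} (η : ℝ) (θ₀ : Θ)

lemma measurable_extrinsicReward (hre : Measurable (Function.uncurry re)) :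
    Measurable fun p : (ℝ × A) × ℝ => extrinsicReward re p.1.1 p.1.2 p.2 :=
  hre.comp measurable_fst

lemma measurable_augmentedReward (hprior : prior ≪ lam) (hre : Measurable (Function.uncurry re))
    (n : ℕ) : Measurable fun p : (Fin n → Transition A) × Transition A =>
      augmentedReward M prior lam re η p.1 p.2.1.1 p.2.1.2 p.2.2 :=
  (hre.comp measurable_snd.fst).add ((measurable_infoGain M prior lam hprior n).const_mul η)

lemma measurable_augmentedReward_right (hprior : prior ≪ lam)
    (hre : Measurable (Function.uncurry re)) {n : ℕ} (D : Fin n → Transition A) :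
    Measurable fun z : (ℝ × A) × ℝ => augmentedReward M prior lam re η D z.1.1 z.1.2 z.2 :=
  Measurable.comp (g := fun p : (Fin n → Transition A) × Transition A =>
      augmentedReward M prior lam re η p.1 p.2.1.1 p.2.1.2 p.2.2) (f := fun z => (D, z))
    (measurable_augmentedReward M prior lam η hprior hre n) measurable_prodMk_left

/-- The error of the mean one-step reward of the BAMDP. -/
def rewardError (re : ℝ → A → ℝ) {n : ℕ} (D : Fin n → Transition A) (x : ℝ × A) : ℝ≥0∞ :=
  ‖meanReward (M.trans θ₀) (augmentedReward M prior lam re η D) x -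
    meanReward (M.trans θ₀) (extrinsicReward re) x‖ₑ

lemma measurable_rewardError (hprior : prior ≪ lam) (hre : Measurable (Function.uncurry re))
    (n : ℕ) : Measurable fun p : (Fin n → Transition A) × (ℝ × A) =>
      rewardError M prior lam η θ₀ re p.1 p.2 := by
  have h1 : Measurable fun q : ((Fin n → Transition A) × (ℝ × A)) × ℝ =>
      augmentedReward M prior lam re η q.1.1 q.1.2.1 q.1.2.2 q.2 :=
    Measurable.comp (g := fun p : (Fin n → Transition A) × Transition A =>
        augmentedReward M prior lam re η p.1 p.2.1.1 p.2.1.2 p.2.2)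
      (f := fun q : ((Fin n → Transition A) × (ℝ × A)) × ℝ => (q.1.1, (q.1.2, q.2)))
      (measurable_augmentedReward M prior lam η hprior hre n)
      (measurable_fst.fst.prodMk (measurable_fst.snd.prodMk measurable_snd))
  have h2 := (StronglyMeasurable.integral_kernel_prod_right'
    (κ := Kernel.prodMkLeft (Fin n → Transition A) (M.trans θ₀)) h1.stronglyMeasurable).measurable
  exact (h2.sub ((measurable_meanReward (M.trans θ₀)
    (measurable_extrinsicReward hre)).comp measurable_snd)).enorm

omit [∀ n, IsMarkovKernel (ρ n)] in
/-- At a fixed state-action pair, the reward error is almost surely the expected information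
gain. -/
lemma ae_rewardError_eq (hprior : prior ≪ lam) (hIG : BoundedInfoGain M prior lam ρ θ₀)
    (x : ℝ × A) (n : ℕ) :
    ∀ᵐ D ∂(dataLaw M ρ θ₀ n), rewardError M prior lam η θ₀ re D x =
      ‖η‖ₑ * ‖∫ y, infoGain M prior lam D x.1 x.2 y ∂(M.trans θ₀ x)‖ₑ := by
  obtain ⟨C, hC⟩ := hIG
  have hm : Measurable fun p : (Fin n → Transition A) × ℝ =>
      ‖infoGain M prior lam p.1 x.1 x.2 p.2‖ₑ ^ 2 :=
    ((Measurable.comp (g := fun p : (Fin n → Transition A) × Transition A =>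
        infoGain M prior lam p.1 p.2.1.1 p.2.1.2 p.2.2)
      (f := fun p : (Fin n → Transition A) × ℝ => (p.1, (x, p.2)))
      (measurable_infoGain M prior lam hprior n)
      (measurable_fst.prodMk (measurable_const.prodMk measurable_snd))).enorm).pow_const 2
  -- The averaged moment bound gives integrability of the gain only for almost every `D`; only there
  -- does the mean reward split by linearity.
  have hfin : ∫⁻ D, ∫⁻ y, ‖infoGain M prior lam D x.1 x.2 y‖ₑ ^ 2 ∂(M.trans θ₀ x)
      ∂(dataLaw M ρ θ₀ n) ≠ ∞ := by
    refine ((lintegral_mono fun D => ?_).trans_lt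
      ((hC n x.1 x.2).trans_lt ENNReal.coe_lt_top)).ne
    rw [lintegral_add_measure]
    exact le_self_add
  filter_upwards [ae_lt_top (hm.lintegral_prod_right' (ν := M.trans θ₀ x)) hfin] with D hD
  have hg := measurable_infoGain_right M prior lam hprior D x
  have hint : Integrable (infoGain M prior lam D x.1 x.2) (M.trans θ₀ x) := by
    refine ⟨hg.aestronglyMeasurable, ?_⟩
    have hle : ∀ b : ℝ≥0∞, b ≤ b ^ 2 + 1 := fun b => by
      rcases le_total b 1 with h | h
      · exact le_add_left h
      · refine le_add_right ?_
        rw [sq]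
        exact le_mul_of_one_le_right' h
    refine (lintegral_mono fun y => hle _).trans_lt ?_
    rw [lintegral_add_right _ measurable_const]
    simpa using hD
  have h1 : meanReward (M.trans θ₀) (augmentedReward M prior lam re η D) x =
      re x.1 x.2 + η * ∫ y, infoGain M prior lam D x.1 x.2 y ∂(M.trans θ₀ x) := by
    simp only [meanReward, augmentedReward]
    rw [integral_add (integrable_const _) (hint.const_mul η), integral_const_mul]
    simp
  have h2 : meanReward (M.trans θ₀) (extrinsicReward re) x = re x.1 x.2 := by
    simp [meanReward, extrinsicReward]
  rw [rewardError, h1, h2, add_sub_cancel_left, enorm_mul]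

/-- A quantity controlled by the reward error, averaged over a finite measure of state-action
pairs, converges in probability. -/
lemma tendstoInProb_of_enorm_sub_le [PseudoMetricSpace Θ] [OpensMeasurableSpace Θ]
    (hmean : ∀ x : ℝ × A, ContinuousAt (fun θ => M.mean θ x) θ₀)
    (hvar : ContinuousAt M.var θ₀) (hprior : prior ≪ lam)
    (hKL : KLSupport M prior ρ θ₀) (htest : Testable M ρ θ₀)
    (hent : ∀ (n : ℕ) (D : Fin n → Transition A),
      Integrable (llr (bayesPosterior M prior D) lam) (bayesPosterior M prior D))
    (hIG : BoundedInfoGain M prior lam ρ θ₀) (hre : Measurable (Function.uncurry re))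
    (ν : Measure (ℝ × A)) [IsFiniteMeasure ν]
    {Y : (n : ℕ) → (Fin n → Transition A) → ℝ} {y : ℝ}
    (hY : ∀ n D, ‖Y n D - y‖ₑ ≤ ∫⁻ x, rewardError M prior lam η θ₀ re D x ∂ν) :
    TendstoInProb (dataLaw M ρ θ₀) Y y := by
  have hm := measurable_rewardError M prior lam η θ₀ hprior hre
  have hae := ae_rewardError_eq M prior lam ρ (re := re) η θ₀ hprior hIG
  have hlim : Tendsto (fun n => ∫⁻ D, ∫⁻ x, rewardError M prior lam η θ₀ re D x ∂ν
      ∂(dataLaw M ρ θ₀ n)) atTop (𝓝 0) := by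
    -- The vanishing of the gain is known for each fixed `x`, so the data are integrated out first.
    have hsw : ∀ n, ∫⁻ D, ∫⁻ x, rewardError M prior lam η θ₀ re D x ∂ν ∂(dataLaw M ρ θ₀ n) =
        ∫⁻ x, ∫⁻ D, rewardError M prior lam η θ₀ re D x ∂(dataLaw M ρ θ₀ n) ∂ν := fun n =>
      lintegral_lintegral_swap (hm n).aemeasurable
    have hx : ∀ n x, ∫⁻ D, rewardError M prior lam η θ₀ re D x ∂(dataLaw M ρ θ₀ n) =
        ‖η‖ₑ * ∫⁻ D, ‖∫ y, infoGain M prior lam D x.1 x.2 y ∂(M.trans θ₀ x)‖ₑ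
          ∂(dataLaw M ρ θ₀ n) := fun n x => by
      rw [lintegral_congr_ae (hae x n), lintegral_const_mul' _ _ enorm_ne_top]
    simp_rw [hsw]
    obtain ⟨C, hC⟩ := hIG
    have key := tendsto_lintegral_of_dominated_convergence (μ := ν) (f := fun _ => 0)
      (F := fun n x => ∫⁻ D, rewardError M prior lam η θ₀ re D x ∂(dataLaw M ρ θ₀ n))
      (fun _ => ‖η‖ₑ * (C + 1)) (fun n => (hm n).lintegral_prod_left') ?_ ?_ ?_
    · simpa using key
    -- Domination: the crude moment bound at `τ = 1` gives `C + 1`, uniformly in `n` and `x` because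
    -- `C` does not depend on the pair.
    · refine fun n => ae_of_all _ fun x => ?_
      beta_reduce
      rw [hx]
      gcongr
      calc _ ≤ ∫⁻ D, (gainMoment M prior lam θ₀ D x + 1) ∂(dataLaw M ρ θ₀ n) := by
            refine lintegral_mono fun D => (enorm_integral_le_lintegral_enorm _).trans ?_
            simpa using enorm_integral_infoGain_le_moment M prior lam hprior θ₀ D x one_pos
        _ ≤ _ := by
            rw [lintegral_add_right _ measurable_const]
            simp only [lintegral_const, measure_univ, mul_one]
            gcongr
            exact hC n x.1 x.2
    · rw [lintegral_const]
      exact ENNReal.mul_ne_top (ENNReal.mul_ne_top enorm_ne_top (by simp)) (measure_ne_top _ _)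
    · refine ae_of_all _ fun x => ?_
      simp_rw [hx]
      simpa using ENNReal.Tendsto.const_mul (tendsto_lintegral_enorm_integral_infoGain M prior lam
        ρ hmean hvar hprior hKL htest hent ⟨C, hC⟩ x) (Or.inr (enorm_ne_top (x := η)))
  intro ε hε
  have hε' : ENNReal.ofReal ε ≠ 0 := by simpa using hε
  have hlim' := ENNReal.Tendsto.const_mul hlim
    (Or.inr (ENNReal.inv_ne_top.mpr hε') : (0 : ℝ≥0∞) ≠ 0 ∨ (ENNReal.ofReal ε)⁻¹ ≠ ∞)
  rw [mul_zero] at hlim'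
  refine tendsto_of_tendsto_of_tendsto_of_le_of_le tendsto_const_nhds hlim'
    (fun n => bot_le) fun n => ?_
  have h1 := mul_meas_ge_le_lintegral₀ (μ := dataLaw M ρ θ₀ n)
    ((hm n).lintegral_prod_right' (ν := ν)).aemeasurable (ENNReal.ofReal ε)
  calc dataLaw M ρ θ₀ n {D | ε ≤ |Y n D - y|} ≤ dataLaw M ρ θ₀ n {D | ENNReal.ofReal ε ≤
        ∫⁻ x, rewardError M prior lam η θ₀ re D x ∂ν} := by
        refine measure_mono fun D hD => le_trans ?_ (hY n D)
        rw [Real.enorm_eq_ofReal_abs]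
        exact ENNReal.ofReal_le_ofReal hD
    _ = (ENNReal.ofReal ε)⁻¹ * (ENNReal.ofReal ε * dataLaw M ρ θ₀ n {D | ENNReal.ofReal ε ≤
        ∫⁻ x, rewardError M prior lam η θ₀ re D x ∂ν}) := by
        rw [← mul_assoc, ENNReal.inv_mul_cancel hε' ENNReal.ofReal_ne_top, one_mul]
    _ ≤ _ := by gcongr

end Convergence

end InfoGain

end

theorem mainTheorem2
    {A Θ : Type*} [MeasurableSpace A]
    [MeasurableSpace Θ] [PseudoMetricSpace Θ] [OpensMeasurableSpace Θ]
    -- the model `S' = f(S, A) + N(0, σ²)` with `θ = (f, σ²)`, and the true parameter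
    (M : GaussianDynamics A Θ) (θ₀ : Θ)
    (hmean : ∀ x : ℝ × A, ContinuousAt (fun θ => M.mean θ x) θ₀)
    (hvar : ContinuousAt M.var θ₀)
    -- the prior, with a density with respect to a reference measure
    (prior : Measure Θ) [IsProbabilityMeasure prior]
    (lam : Measure Θ) [SigmaFinite lam] (hprior : prior ≪ lam)
    -- the rule by which the observed state-action pairs are chosen
    (ρ : (n : ℕ) → Kernel (Fin n → Transition A) (ℝ × A)) [∀ n, IsMarkovKernel (ρ n)]
    -- conditions for posterior consistency
    (hKL : KLSupport M prior ρ θ₀) (htest : Testable M ρ θ₀)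
    -- posterior entropies are finite and the intrinsic rewards are bounded in mean square
    (hent : ∀ (n : ℕ) (D : Fin n → Transition A),
      Integrable (llr (bayesPosterior M prior D) lam) (bayesPosterior M prior D))
    (hIG : BoundedInfoGain M prior lam ρ θ₀)
    -- the MDP, the policy and the weight of the intrinsic reward
    (re : ℝ → A → ℝ) (hre : Measurable (Function.uncurry re))
    (hre_bdd : ∃ K : ℝ, ∀ s a, |re s a| ≤ K)
    (p0 : Measure ℝ) [IsProbabilityMeasure p0]
    (γ : ℝ) (hγ0 : 0 < γ) (hγ1 : γ < 1)
    (pol : Kernel ℝ A) [IsMarkovKernel pol] (η : ℝ) :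
    (∀ s : ℝ, TendstoInProb (dataLaw M ρ θ₀)
      (fun _ D => stateValue (M.trans θ₀) pol γ (augmentedReward M prior lam re η D) s)
      (stateValue (M.trans θ₀) pol γ (extrinsicReward re) s)) ∧
    (∀ (s : ℝ) (a : A), TendstoInProb (dataLaw M ρ θ₀)
      (fun _ D => actionValue (M.trans θ₀) pol γ (augmentedReward M prior lam re η D) s a)
      (actionValue (M.trans θ₀) pol γ (extrinsicReward re) s a)) ∧
    (∀ T : ℕ, TendstoInProb (dataLaw M ρ θ₀)
      (fun _ D => discountedReturn (M.trans θ₀) pol p0 γ (augmentedReward M prior lam re η D) T)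
      (discountedReturn (M.trans θ₀) pol p0 γ (extrinsicReward re) T)) ∧
    TendstoInProb (dataLaw M ρ θ₀)
      (fun _ D => discountedReturnInf (M.trans θ₀) pol p0 γ (augmentedReward M prior lam re η D))
      (discountedReturnInf (M.trans θ₀) pol p0 γ (extrinsicReward re)) := by
  obtain ⟨K, hK⟩ := hre_bdd
  have hr₀ := measurable_extrinsicReward hre
  have hK' : ∀ s a s', |extrinsicReward re s a s'| ≤ K := fun s a _ => hK s a
  have hr : ∀ {n : ℕ} (D : Fin n → Transition A), Measurable fun z : (ℝ × A) × ℝ =>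
      augmentedReward M prior lam re η D z.1.1 z.1.2 z.2 := fun D =>
    measurable_augmentedReward_right M prior lam η hprior hre D
  have hfin : ∀ (μ : Measure ℝ) [IsProbabilityMeasure μ],
      IsFiniteMeasure (discountedOccupation (M.trans θ₀) pol γ μ) := fun μ _ =>
    isFiniteMeasure_discountedOccupation (M.trans θ₀) pol hγ0 hγ1 μ
  -- Each value differs from its MDP counterpart by at most the reward error integrated against one
  -- finite measure independent of `n` and `D`; both kinds of horizon share the measure started from
  -- `p0`.
  refine ⟨fun s => ?_, fun s a => ?_, fun T => ?_, ?_⟩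
  · have := hfin (Measure.dirac s)
    exact tendstoInProb_of_enorm_sub_le M prior lam ρ η θ₀ hmean hvar hprior hKL htest hent hIG hre
      _ fun n D => enorm_stateValue_sub_le (M.trans θ₀) pol hγ0 hγ1 (hr D) hr₀ hK' s
  · have := hfin (M.trans θ₀ (s, a))
    have : IsFiniteMeasure (ENNReal.ofReal γ •
        discountedOccupation (M.trans θ₀) pol γ (M.trans θ₀ (s, a))) :=
      Measure.smul_finite _ ENNReal.ofReal_ne_top
    exact tendstoInProb_of_enorm_sub_le M prior lam ρ η θ₀ hmean hvar hprior hKL htest hent hIG hre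
      _ fun n D => enorm_actionValue_sub_le (M.trans θ₀) pol hγ0 hγ1 (hr D) hr₀ hK' s a
  · have := hfin p0
    exact tendstoInProb_of_enorm_sub_le M prior lam ρ η θ₀ hmean hvar hprior hKL htest hent hIG hre
      _ fun n D => enorm_discountedReturn_sub_le (M.trans θ₀) pol hγ0 (hr D) hr₀ hK' p0 T
  · have := hfin p0
    exact tendstoInProb_of_enorm_sub_le M prior lam ρ η θ₀ hmean hvar hprior hKL htest hent hIG hre
      _ fun n D => enorm_discountedReturnInf_sub_le (M.trans θ₀) pol hγ0 hγ1 (hr D) hr₀ hK' p0
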